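/- Let $V\ge 1$ and let $s(1),\dots,s(V)\ge 0$ with $\sum_j s(j)=1$ and $s(V)\neq 0$. In the LRU stack model, $V$ items are kept in a stack ordered by recency; at each step an independent depth $d$ with $\Pr[d=j]=s(j)$ is drawn, the item at depth $d$ is accessed, and it moves to the top while the items above it move down by one. *Single item.* A stationary single-item policy is a set of depths at which the item is evicted from the buffer when it gets there (it re-enters the buffer when it is next accessed, and an access while it is out is a miss). Its cost point is the pair (long-run average occupancy, long-run expected miss rate of this item), for an item started at the top of the stack and in the buffer. Let $\mathrm{ev}_k$ be the policy that keeps the item at depths $\le k$ and evicts it at depths $>k$. The policy $\mathrm{ev}_k$ is a supported efficient (Pareto-convex) policy if no convex combination of the other cost points is $\le$ its cost point in both coordinates. Let $q_1<q_2<\dots<q_l$ be the $k\in\{1,\dots,V\}$ for which $\mathrm{ev}_k$ is supported efficient. The average-occupancy optimum for occupancy $C$ is the least $V\zeta$ over the convex combinations $(\eta,\zeta)$ of cost points with $V\eta=C$. *Fixed capacity.* A buffer of capacity $C$ always receives the accessed item; when a miss occurs and the buffer is full, exactly one item in it is evicted, and otherwise nothing is. Policies may depend on the time, the state (stack and buffer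 content) and the current depth $d$. The $K$-$L$ policy evicts, on a miss with full buffer and in terms of the stack just after the update, the item at depth $L+1$ if it is in the buffer, otherwise the item at depth $K+1$ (and, should neither be in the buffer, the least recently used item of the buffer). A policy is gain optimal with miss rate $M$ if, from the empty buffer and any initial stack, its expected number of misses in $\tau$ steps divided by $\tau$ tends to $M$, and no policy for capacity $C$, from any initial state, has a lower limit of this ratio below $M$. *Algorithm* (on input $V$ and $s$): 1. $\nu[1]\leftarrow 1$, $\pi[1]\leftarrow s(1)$, $\Delta[1]\leftarrow 1$, $\pi[V+1]\leftarrow 0$, $\Delta[V+1]\leftarrow 1$. 2. For $j=V$ down to $2$: $\nu[j]\leftarrow j$, $\pi[j]\leftarrow s(j)$, $\Delta[j]\leftarrow 1$, $n\leftarrow \nu[j]+1$; while $\pi[j]/\Delta[j]\le \pi[n]/\Delta[n]$: $\nu[j]\leftarrow\nu[n]$, $\pi[j]\leftarrow\pi[j]+\pi[n]$, $\Delta[j]\leftarrow\Delta[j]+\Delta[n]$, $n\leftarrow\nu[j]+1$. 3. $j\leftarrow 1$, $i\leftarrow 1$; while $j\le V$: print "$q_i=\nu[j]$", $j\leftarrow\nu[j]+1$,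 $i\leftarrow i+1$. 4. For $j=2,\dots,V$: print "$\xi(j)=\pi[j]/\Delta[j]$". **Claim.** $q_1=1$ and $q_l=V$, and the lines printed in step 3 are exactly the values $q_1,\dots,q_l$, in order. On a real RAM with unit cost the algorithm runs in time $\Theta(V)$: between $c_1V$ and $c_2V$ for absolute constants $c_1,c_2>0$ that depend neither on $V$ nor on $s$. Moreover, with the convention $q_0=0$, for every integer $1\le C\le V$ there is exactly one pair of consecutive values $K(C)=q_i<C\le q_{i+1}=L(C)$, and the $K(C)$-$L(C)$ policy is gain optimal for the fixed capacity $C$; its miss rate equals the average-occupancy optimum for occupancy $C$. -/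

import Mathlib

namespace LRUSM

/-! ### Long-run expected costs of a system driven by i.i.d. stack depths

A stack distance is an element `d : Fin V`; it stands for the depth `d + 1 ∈ {1, …, V}`.
The stack-distance distribution is a function `s : ℕ → ℝ`, of which only the values
`s 1, …, s V` matter. -/

/-- `s 1, …, s V` is a probability distribution whose last entry is not zero. -/
structure IsStackDistribution (V : ℕ) (s : ℕ → ℝ) : Prop where
  nonneg : ∀ j, 1 ≤ j → j ≤ V → 0 ≤ s j
  sum_eq_one : ∑ j ∈ Finset.Icc 1 V, s j = 1
  last_ne_zero : s V ≠ 0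

/-- The cost accumulated from time `t` and state `x` on, along a finite list of disturbances, by
the system that moves from `x` to `step t x w` and pays `g x w` on disturbance `w`. -/
def totalCost {X W : Type} (g : X → W → ℝ) (step : ℕ → X → W → X) : ℕ → X → List W → ℝ
  | _, _, [] => 0
  | t, x, w :: ws => g x w + totalCost g step (t + 1) (step t x w) ws

/-- The expected cost over the first `τ` steps, started in `x₀` at time `0`, when the `τ`
disturbances are independent stack distances with distribution `s`. -/
noncomputable def expectedCost {V : ℕ} {X : Type} (s : ℕ → ℝ) (g : X → Fin V → ℝ)
    (step : ℕ → X → Fin V → X) (x₀ : X) (τ : ℕ) : ℝ :=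
  ∑ w : Fin τ → Fin V,
    (∏ t, s ((w t : ℕ) + 1)) * totalCost g step 0 x₀ (List.ofFn w)

/-- The expected cost per step converges to `G`. -/
def HasAverageCost {V : ℕ} {X : Type} (s : ℕ → ℝ) (g : X → Fin V → ℝ)
    (step : ℕ → X → Fin V → X) (x₀ : X) (G : ℝ) : Prop :=
  Filter.Tendsto (fun τ : ℕ => expectedCost s g step x₀ τ / τ) Filter.atTop (nhds G)

/-! ### The average occupancy problem for a single item -/

/-- The state of a single item: its position in the LRU stack (`0` is the top of the stack), and
whether it is in the buffer. -/
abbrev ItemState (V : ℕ) : Type := Fin V × Bool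

/-- An item at position `z` is accessed when the stack distance `d` equals `z`, and is then moved
to the top and into the buffer. Otherwise it moves one position down if `z < d` and stays if
`d < z`; it leaves the buffer if the stationary policy `e` evicts at the position reached.
(`Fin.cycleRange d` sends `d` to `0`, each `z < d` to `z + 1`, and fixes each `z > d`.) -/
def itemStep {V : ℕ} (e : Fin V → Bool) (_t : ℕ) (x : ItemState V) (d : Fin V) : ItemState V :=
  (Fin.cycleRange d x.1, if d = x.1 then true else x.2 && !e (Fin.cycleRange d x.1))

/-- Instantaneous occupancy cost. -/
def itemOccupancy {V : ℕ} (x : ItemState V) (_d : Fin V) : ℝ := if x.2 = true then 1 else 0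

/-- Instantaneous miss cost: the item is accessed while it is not in the buffer. -/
def itemMiss {V : ℕ} (x : ItemState V) (d : Fin V) : ℝ :=
  if x.2 = false ∧ d = x.1 then 1 else 0

/-- `p` is the pair (average occupancy, miss rate) of the single-item policy `e`, for the item
started at the top of the stack and in the buffer. -/
def HasItemCosts {V : ℕ} [NeZero V] (s : ℕ → ℝ) (e : Fin V → Bool) (p : ℝ × ℝ) : Prop :=
  HasAverageCost s itemOccupancy (itemStep e) ((0, true) : ItemState V) p.1 ∧
  HasAverageCost s itemMiss (itemStep e) ((0, true) : ItemState V) p.2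

/-- The cost points of all the stationary single-item policies. -/
def itemCostPoints (V : ℕ) [NeZero V] (s : ℕ → ℝ) : Set (ℝ × ℝ) :=
  {p | ∃ e : Fin V → Bool, HasItemCosts s e p}

/-- The policy `ev_k`: keep the item at depths `≤ k`, evict it at depths `> k`. -/
def evPolicy {V : ℕ} (k : ℕ) (i : Fin V) : Bool := decide (k < (i : ℕ) + 1)

/-- `ev_k` is a supported efficient (Pareto-convex) policy: no convex combination of the other
cost points is at most its cost point in both coordinates. -/
def IsSupportedEv (V : ℕ) [NeZero V] (s : ℕ → ℝ) (k : ℕ) : Prop :=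
  ∃ p : ℝ × ℝ, HasItemCosts (V := V) s (evPolicy k) p ∧
    ¬ ∃ y ∈ convexHull ℝ (itemCostPoints V s \ {p}), y ≤ p

/-- `M` is the optimal miss rate of the average occupancy problem with target occupancy `C`:
all the `V` items are managed by the same randomized mixture of single-item policies, the costs
of such mixtures being the convex combinations of the single-item costs. -/
def IsAverageOccupancyOptimum (V : ℕ) [NeZero V] (s : ℕ → ℝ) (C : ℝ) (M : ℝ) : Prop :=
  IsLeast {m : ℝ | ∃ p ∈ convexHull ℝ (itemCostPoints V s), V * p.1 = C ∧ V * p.2 = m} M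

/-! ### The fixed capacity problem -/

/-- State: the LRU stack (`stack i` is the item at depth `i + 1`) and the content of the buffer;
the virtual space of items is `Fin V`. -/
structure BufferState (V : ℕ) where
  stack : Equiv.Perm (Fin V)
  buffer : Finset (Fin V)

/-- The LRU stack after an access at stack distance `d`: the prefix that ends at `d` is cyclically
shifted down by one position. -/
def rotate {V : ℕ} (Λ : Equiv.Perm (Fin V)) (d : Fin V) : Equiv.Perm (Fin V) :=
  (Fin.cycleRange d).symm.trans Λ

/-- A possibly time-dependent policy, which knows the state and the current stack distance; the
control is the item to be evicted, if any. -/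
abbrev Policy (V : ℕ) : Type := ℕ → BufferState V → Fin V → Option (Fin V)

/-- Controls admissible for a buffer of fixed capacity `C`: an item of the buffer is evicted if
a miss occurs while the buffer is full, and no eviction is made otherwise. -/
def AdmissibleControl {V : ℕ} (C : ℕ) (x : BufferState V) (d : Fin V) (u : Option (Fin V)) :
    Prop :=
  if x.stack d ∉ x.buffer ∧ x.buffer.card = C then ∃ j ∈ x.buffer, u = some j else u = none

/-- A policy for a buffer of fixed capacity `C`. -/
def Policy.Admissible {V : ℕ} (C : ℕ) (μ : Policy V) : Prop :=
  ∀ t x d, x.buffer.card ≤ C → AdmissibleControl C x d (μ t x d)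

/-- One step of the controlled system: the stack is rotated, the control is evicted, and the
accessed item is in the buffer afterwards. -/
def bufferStep {V : ℕ} (μ : Policy V) (t : ℕ) (x : BufferState V) (d : Fin V) : BufferState V where
  stack := rotate x.stack d
  buffer := insert (x.stack d) (x.buffer \ (μ t x d).toFinset)

/-- The cost is one on a miss and zero on a hit. -/
def bufferMiss {V : ℕ} (x : BufferState V) (d : Fin V) : ℝ :=
  if x.stack d ∈ x.buffer then 0 else 1

/-- The policy `μ` for capacity `C` is gain optimal, with miss rate `M`: started from the empty
buffer and any stack it has long-run expected miss rate `M`, and for no admissible policy and no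
initial state is the lower limit of the expected miss rate smaller than `M`. -/
def IsGainOptimal {V : ℕ} (s : ℕ → ℝ) (C : ℕ) (μ : Policy V) (M : ℝ) : Prop :=
  μ.Admissible C ∧
  (∀ Λ : Equiv.Perm (Fin V), HasAverageCost s bufferMiss (bufferStep μ) ⟨Λ, ∅⟩ M) ∧
  ∀ μ' : Policy V, μ'.Admissible C → ∀ x₀ : BufferState V, x₀.buffer.card ≤ C →
    ∀ c < M, ∀ᶠ τ : ℕ in Filter.atTop,
      c < expectedCost s bufferMiss (bufferStep μ') x₀ τ / τ

/-- The `K`-`L` eviction policy for capacity `C`. On a miss with a full buffer it evicts, with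
respect to the stack right after the rotation, the item at depth `L + 1` if that is in the buffer;
otherwise the item at depth `K + 1` if that is in the buffer; otherwise (which never happens
from the empty buffer) the least recently used item of the buffer. Depth `L + 1` does not exist
if `L = V`. -/
def klPolicy {V : ℕ} (C K L : ℕ) : Policy V := fun _ x d =>
  if x.stack d ∉ x.buffer ∧ x.buffer.card = C then
    let Λ : List (Fin V) := List.ofFn (rotate x.stack d)
    (Λ[L]?.toList ++ Λ[K]?.toList ++ Λ.reverse).find? (fun j => decide (j ∈ x.buffer))
  else none

/-! ### A real RAM with unit cost

A while language over natural number registers, an array `nu` of natural numbers and arrays of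
real numbers. Evaluating a node of an expression or of a test, writing a register or a cell,
printing, and each branching of a loop cost one unit. -/

inductive NatVar
  | V | i | j | n
  deriving DecidableEq

inductive RealArr
  | s | pi | delta
  deriving DecidableEq

inductive Output
  | q (i : ℕ) (value : ℕ)
  | xi (j : ℕ) (value : ℝ)

structure Store where
  reg : NatVar → ℕ
  nu : ℕ → ℕ
  arr : RealArr → ℕ → ℝ
  /-- what has been printed, in order -/
  out : List Output

inductive NatExpr
  | lit (m : ℕ)
  | reg (x : NatVar)
  | nu (a : NatExpr)
  | add (a b : NatExpr)
  | sub (a b : NatExpr)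

inductive RealExpr
  | lit (m : ℕ)
  | arr (r : RealArr) (a : NatExpr)
  | add (a b : RealExpr)
  | div (a b : RealExpr)

inductive Test
  | natLe (a b : NatExpr)
  | realLe (a b : RealExpr)

inductive Cmd
  | setReg (x : NatVar) (a : NatExpr)
  | setNu (i a : NatExpr)
  | setArr (r : RealArr) (i : NatExpr) (a : RealExpr)
  | printQ (i a : NatExpr)
  | printXi (j : NatExpr) (a : RealExpr)
  | seq (c₁ c₂ : Cmd)
  | loop (b : Test) (c : Cmd)

def NatExpr.eval (σ : Store) : NatExpr → ℕ
  | lit m => m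
  | reg x => σ.reg x
  | nu a => σ.nu (a.eval σ)
  | add a b => a.eval σ + b.eval σ
  | sub a b => a.eval σ - b.eval σ

def NatExpr.cost : NatExpr → ℕ
  | lit _ => 1
  | reg _ => 1
  | nu a => a.cost + 1
  | add a b => a.cost + b.cost + 1
  | sub a b => a.cost + b.cost + 1

noncomputable def RealExpr.eval (σ : Store) : RealExpr → ℝ
  | lit m => m
  | arr r a => σ.arr r (a.eval σ)
  | add a b => a.eval σ + b.eval σ
  | div a b => a.eval σ / b.eval σ

def RealExpr.cost : RealExpr → ℕ
  | lit _ => 1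
  | arr _ a => a.cost + 1
  | add a b => a.cost + b.cost + 1
  | div a b => a.cost + b.cost + 1

def Test.holds (σ : Store) : Test → Prop
  | natLe a b => a.eval σ ≤ b.eval σ
  | realLe a b => a.eval σ ≤ b.eval σ

def Test.cost : Test → ℕ
  | natLe a b => a.cost + b.cost + 1
  | realLe a b => a.cost + b.cost + 1

/-- `Exec c σ σ' T`: the command `c`, started in the store `σ`, terminates in the store `σ'` after
`T` units of time. -/
inductive Exec : Cmd → Store → Store → ℕ → Prop
  | setReg (x : NatVar) (a : NatExpr) (σ : Store) :
      Exec (.setReg x a) σ { σ with reg := Function.update σ.reg x (a.eval σ) } (a.cost + 1)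
  | setNu (i a : NatExpr) (σ : Store) :
      Exec (.setNu i a) σ { σ with nu := Function.update σ.nu (i.eval σ) (a.eval σ) }
        (i.cost + a.cost + 1)
  | setArr (r : RealArr) (i : NatExpr) (a : RealExpr) (σ : Store) :
      Exec (.setArr r i a) σ
        { σ with arr := Function.update σ.arr r
                          (Function.update (σ.arr r) (i.eval σ) (a.eval σ)) }
        (i.cost + a.cost + 1)
  | printQ (i a : NatExpr) (σ : Store) :
      Exec (.printQ i a) σ { σ with out := σ.out ++ [Output.q (i.eval σ) (a.eval σ)] }
        (i.cost + a.cost + 1)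
  | printXi (j : NatExpr) (a : RealExpr) (σ : Store) :
      Exec (.printXi j a) σ { σ with out := σ.out ++ [Output.xi (j.eval σ) (a.eval σ)] }
        (j.cost + a.cost + 1)
  | seq {c₁ c₂ : Cmd} {σ σ₁ σ₂ : Store} {T₁ T₂ : ℕ} :
      Exec c₁ σ σ₁ T₁ → Exec c₂ σ₁ σ₂ T₂ → Exec (.seq c₁ c₂) σ σ₂ (T₁ + T₂)
  | loopExit {b : Test} {c : Cmd} {σ : Store} :
      ¬ b.holds σ → Exec (.loop b c) σ σ (b.cost + 1)
  | loopStep {b : Test} {c : Cmd} {σ σ₁ σ₂ : Store} {T₁ T₂ : ℕ} :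
      b.holds σ → Exec c σ σ₁ T₁ → Exec (.loop b c) σ₁ σ₂ T₂ →
      Exec (.loop b c) σ σ₂ (b.cost + 1 + T₁ + T₂)

/-! ### The specialized Graham scan -/

local infixr:40 ";;" => Cmd.seq

section Program

open NatVar RealArr

/-- `π[a] / Δ[a]` -/
def ratio (a : NatExpr) : RealExpr := .div (.arr pi a) (.arr delta a)

/-- `n ← ν[j] + 1` -/
def setNext : Cmd := .setReg n (.add (.nu (.reg j)) (.lit 1))

/-- Initialization of cell `1` and of the sentinel cell `V + 1`. -/
def scanInit : Cmd :=
  .setNu (.lit 1) (.lit 1) ;;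
  .setArr pi (.lit 1) (.arr s (.lit 1)) ;;
  .setArr delta (.lit 1) (.lit 1) ;;
  .setArr pi (.add (.reg V) (.lit 1)) (.lit 0) ;;
  .setArr delta (.add (.reg V) (.lit 1)) (.lit 1)

/-- `while π[j]/Δ[j] ≤ π[n]/Δ[n]`: merge the block that starts at `n` into the one at `j`. -/
def scanMerge : Cmd :=
  .loop (.realLe (ratio (.reg j)) (ratio (.reg n))) (
    .setNu (.reg j) (.nu (.reg n)) ;;
    .setArr pi (.reg j) (.add (.arr pi (.reg j)) (.arr pi (.reg n))) ;;
    .setArr delta (.reg j) (.add (.arr delta (.reg j)) (.arr delta (.reg n))) ;;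
    setNext)

/-- `for j ← V downto 2` -/
def scanMain : Cmd :=
  .setReg j (.reg V) ;;
  .loop (.natLe (.lit 2) (.reg j)) (
    .setNu (.reg j) (.reg j) ;;
    .setArr pi (.reg j) (.arr s (.reg j)) ;;
    .setArr delta (.reg j) (.lit 1) ;;
    setNext ;;
    scanMerge ;;
    .setReg j (.sub (.reg j) (.lit 1)))

/-- Print the segmentation `q₁, q₂, …`. -/
def scanPrintQ : Cmd :=
  .setReg j (.lit 1) ;;
  .setReg i (.lit 1) ;;
  .loop (.natLe (.reg j) (.reg V)) (
    .printQ (.reg i) (.nu (.reg j)) ;;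
    .setReg j (.add (.nu (.reg j)) (.lit 1)) ;;
    .setReg i (.add (.reg i) (.lit 1)))

/-- Print the priorities `ξ(2), …, ξ(V)`. -/
def scanPrintXi : Cmd :=
  .setReg j (.lit 2) ;;
  .loop (.natLe (.reg j) (.reg V)) (
    .printXi (.reg j) (ratio (.reg j)) ;;
    .setReg j (.add (.reg j) (.lit 1)))

/-- The whole algorithm. -/
def grahamScan : Cmd := scanInit ;; scanMain ;; scanPrintQ ;; scanPrintXi

end Program

/-- The initial stores: register `V` holds `V`, array `s` holds `s 1, …, s V`, nothing has been
printed; all the rest of the memory is arbitrary. -/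
structure IsInput (V : ℕ) (s : ℕ → ℝ) (σ : Store) : Prop where
  reg_V : σ.reg .V = V
  arr_s : ∀ j, 1 ≤ j → j ≤ V → σ.arr .s j = s j
  out_nil : σ.out = []

/-- The pairs `(value, i)` of the printed lines `q_i = value`, in order. -/
def printedQ (o : List Output) : List (ℕ × ℕ) :=
  o.filterMap fun
    | .q i v => some (v, i)
    | .xi _ _ => none

end LRUSM

/-! The position of a single item averages uniformly over the stack, and an evicted item stays out
until its next access. So a stationary policy matters only through its first eviction depth below
the top: it costs as much as some `ev_k`, whose point is `(k / V, tail s k / V)`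
(`itemCostPoints_eq`). The supported efficient policies are therefore the vertices of the lower
convex hull of `tail s` on `[1, V]`, that is, of the upper concave hull of `cum s = 1 - tail s`.
Because `s V > 0`, all edges of that concave hull have positive slope, so every vertex up to `V` is
efficient (`HullChain.mem_iff_isSupportedEv`).

The fixed capacity problem is solved by Lagrangian duality. Let `r` be the slope of the concave hull
edge from `K` to `L` over `C`; charge rent `r` per occupied place. The rented problem splits into
independent items, each with an explicit relative value (`itemValue`). The sum of these values is a
subsolution of the Poisson equation for every policy (`le_sum_step`), whence the lower bound `w - r
* C`. Evicting costs nothing exactly at depths where the supporting line `w = tail s z + r * z` is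
tight; once full, a `K`-`L` buffer contains the top `K` items and lies within the top `L`, so the
policy evicts only at the two ends of the edge and attains the bound (`klPolicy_isGainOptimal`). The
same line gives the average-occupancy optimum, hence the equality of the two.

The scan computes, from right to left, the hull vertex that follows each `m` (`IsNext`). Merging two
neighbouring blocks replaces two edges by their chord; each merge destroys a block and each outer
turn creates one, so the time is linear (`exec_scanMerge`, `exec_grahamScan`). -/

namespace LRUSM

open Finset

/-! ### Average costs from approximate solutions of the Poisson equation -/

section AverageCost

variable {V : ℕ} {X : Type} {s : ℕ → ℝ} {g : X → Fin V → ℝ} {step : ℕ → X → Fin V → X}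

/-- The expected cost over `τ` steps, started in `x` at time `t`. -/
noncomputable def expectedCostFrom (s : ℕ → ℝ) (g : X → Fin V → ℝ)
    (step : ℕ → X → Fin V → X) (t : ℕ) (x : X) (τ : ℕ) : ℝ :=
  ∑ w : Fin τ → Fin V, (∏ i, s ((w i : ℕ) + 1)) * totalCost g step t x (List.ofFn w)

theorem sum_prod_eq_one (hs : ∑ d : Fin V, s (d + 1) = 1) (τ : ℕ) :
    ∑ w : Fin τ → Fin V, ∏ i, s ((w i : ℕ) + 1) = 1 := by
  have := Finset.prod_univ_sum (fun _ : Fin τ => (univ : Finset (Fin V)))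
    (fun _ d => s ((d : ℕ) + 1))
  rw [Fintype.piFinset_univ] at this
  rw [← this]
  simp [hs]

theorem expectedCostFrom_zero (t : ℕ) (x : X) : expectedCostFrom s g step t x 0 = 0 := by
  simp [expectedCostFrom, totalCost]

theorem expectedCostFrom_succ (hs : ∑ d : Fin V, s (d + 1) = 1) (t : ℕ) (x : X) (τ : ℕ) :
    expectedCostFrom s g step t x (τ + 1) =
      ∑ d : Fin V, s (d + 1) * (g x d + expectedCostFrom s g step (t + 1) (step t x d) τ) := by
  unfold expectedCostFrom
  rw [← (Fin.consEquiv fun _ : Fin (τ + 1) => Fin V).sum_comp, Fintype.sum_prod_type]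
  refine Finset.sum_congr rfl fun d _ => ?_
  have h1 : ∀ w : Fin τ → Fin V,
      (∏ i, s (((Fin.consEquiv fun _ : Fin (τ + 1) => Fin V) (d, w) i : ℕ) + 1)) *
        totalCost g step t x (List.ofFn ((Fin.consEquiv fun _ : Fin (τ + 1) => Fin V) (d, w))) =
      s (d + 1) * g x d * (∏ i, s ((w i : ℕ) + 1)) + s (d + 1) *
        ((∏ i, s ((w i : ℕ) + 1)) * totalCost g step (t + 1) (step t x d) (List.ofFn w)) := by
    intro w
    rw [Fin.prod_univ_succ, List.ofFn_succ]
    simp only [Fin.consEquiv, Equiv.coe_fn_mk, Fin.cons_zero, Fin.cons_succ, totalCost]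
    ring
  simp only [h1]
  rw [Finset.sum_add_distrib, ← Finset.mul_sum, ← Finset.mul_sum, sum_prod_eq_one hs]
  ring

/-- The inequality for `h` telescopes: the expected cost is at least `τ * G + h x` minus the
expected final value of `h`, which is at most `B`. -/
theorem le_expectedCostFrom (h0 : ∀ d : Fin V, 0 ≤ s (d + 1)) (hs : ∑ d : Fin V, s (d + 1) = 1)
    {I : X → Prop} (hI : ∀ t x d, I x → I (step t x d)) {h : X → ℝ} {B G : ℝ} (hB : ∀ x, h x ≤ B)
    (hG : ∀ t x, I x → G + h x ≤ ∑ d : Fin V, s (d + 1) * (g x d + h (step t x d)))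
    (τ : ℕ) : ∀ t x, I x → τ * G + h x - B ≤ expectedCostFrom s g step t x τ := by
  induction τ with
  | zero =>
    intro t x _
    rw [expectedCostFrom_zero]
    simpa using hB x
  | succ τ ih =>
    intro t x hx
    rw [expectedCostFrom_succ hs]
    have h1 : ∑ d : Fin V, s (d + 1) * (g x d + (τ * G + h (step t x d) - B)) ≤
        ∑ d : Fin V, s (d + 1) * (g x d + expectedCostFrom s g step (t + 1) (step t x d) τ) :=
      Finset.sum_le_sum fun d _ => mul_le_mul_of_nonneg_left
        (by linarith [ih (t + 1) (step t x d) (hI t x d hx)]) (h0 d)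
    have h2 : ∑ d : Fin V, s (d + 1) * (g x d + (τ * G + h (step t x d) - B)) =
        ∑ d : Fin V, s (d + 1) * (g x d + h (step t x d)) + (τ * G - B) := by
      rw [← one_mul (τ * G - B), ← hs, Finset.sum_mul, ← Finset.sum_add_distrib]
      exact Finset.sum_congr rfl fun d _ => by ring
    have := hG t x hx
    push_cast
    linarith

theorem expectedCostFrom_neg (t : ℕ) (x : X) (τ : ℕ) :
    expectedCostFrom s (fun x d => - g x d) step t x τ = - expectedCostFrom s g step t x τ := by
  have : ∀ (l : List (Fin V)) t x,
      totalCost (fun x d => - g x d) step t x l = - totalCost g step t x l := by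
    intro l
    induction l with
    | nil => intro t x; simp [totalCost]
    | cons d l ih => intro t x; simp only [totalCost, ih]; ring
  simp [expectedCostFrom, this]

/-- A lower bound on the average cost, from a subsolution of the Poisson equation. -/
theorem eventually_lt_expectedCost [Finite X] (h0 : ∀ d : Fin V, 0 ≤ s (d + 1))
    (hs : ∑ d : Fin V, s (d + 1) = 1) {I : X → Prop} (hI : ∀ t x d, I x → I (step t x d))
    (h : X → ℝ) {G : ℝ}
    (hG : ∀ t x, I x → G + h x ≤ ∑ d : Fin V, s (d + 1) * (g x d + h (step t x d)))
    {x₀ : X} (hx₀ : I x₀) {c : ℝ} (hc : c < G) :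
    ∀ᶠ τ : ℕ in Filter.atTop, c < expectedCost s g step x₀ τ / τ := by
  obtain ⟨B, hB⟩ := (Set.finite_range h).bddAbove
  have hB' : ∀ x, h x ≤ B := fun x => hB ⟨x, rfl⟩
  have h1 := le_expectedCostFrom h0 hs hI hB' hG
  obtain ⟨N, hN⟩ := exists_nat_gt ((B - h x₀) / (G - c))
  filter_upwards [Filter.eventually_ge_atTop (N + 1)] with τ hτ
  have hτ' : ((N : ℝ) + 1) ≤ τ := by exact_mod_cast hτ
  have hN0 : (0 : ℝ) ≤ N := N.cast_nonneg
  have h2 := h1 τ 0 x₀ hx₀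
  rw [div_lt_iff₀ (by linarith)] at hN
  rw [lt_div_iff₀ (by linarith)]
  change _ < expectedCostFrom s g step 0 x₀ τ
  nlinarith

/-- The average cost, from a sub- and a supersolution of the Poisson equation. -/
theorem hasAverageCost_of_le_of_ge [Finite X] (h0 : ∀ d : Fin V, 0 ≤ s (d + 1))
    (hs : ∑ d : Fin V, s (d + 1) = 1) {I : X → Prop} (hI : ∀ t x d, I x → I (step t x d))
    (h h' : X → ℝ) {G : ℝ}
    (hG : ∀ t x, I x → G + h x ≤ ∑ d : Fin V, s (d + 1) * (g x d + h (step t x d)))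
    (hG' : ∀ t x, I x → ∑ d : Fin V, s (d + 1) * (g x d + h' (step t x d)) ≤ G + h' x)
    {x₀ : X} (hx₀ : I x₀) : HasAverageCost s g step x₀ G := by
  refine tendsto_order.2 ⟨fun c hc => eventually_lt_expectedCost h0 hs hI h hG hx₀ hc,
    fun c hc => ?_⟩
  -- A supersolution for `g` is a subsolution for `-g`, so the upper bound is the lower bound for
  -- the negated cost. The two potentials may differ.
  have := eventually_lt_expectedCost (g := fun x d => - g x d) h0 hs hI (fun x => - h' x)
    (G := -G) (fun t x hx => ?_) hx₀ (neg_lt_neg hc)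
  · filter_upwards [this] with τ hτ
    have h3 : expectedCost s (fun x d => - g x d) step x₀ τ = - expectedCost s g step x₀ τ :=
      expectedCostFrom_neg 0 x₀ τ
    rw [h3, neg_div] at hτ
    exact neg_lt_neg_iff.1 hτ
  · have h4 := hG' t x hx
    have h5 : ∑ d : Fin V, s (d + 1) * (-g x d + -h' (step t x d)) =
        - ∑ d : Fin V, s (d + 1) * (g x d + h' (step t x d)) := by
      rw [← Finset.sum_neg_distrib]
      exact Finset.sum_congr rfl fun d _ => by ring
    rw [h5]
    linarith

end AverageCost

/-! ### Cumulated distribution and the motion of one item in the stack -/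

/-- `s 1 + ⋯ + s k` -/
noncomputable def cum (s : ℕ → ℝ) (k : ℕ) : ℝ := ∑ i ∈ range k, s (i + 1)

/-- The tail `1 - (s 1 + ⋯ + s k)`, the miss rate of an LRU buffer of capacity `k`. -/
noncomputable def tail (s : ℕ → ℝ) (k : ℕ) : ℝ := 1 - cum s k

theorem cum_zero (s : ℕ → ℝ) : cum s 0 = 0 := by simp [cum]

theorem cum_succ (s : ℕ → ℝ) (k : ℕ) : cum s (k + 1) = cum s k + s (k + 1) := by
  simp [cum, Finset.sum_range_succ]

theorem tail_succ (s : ℕ → ℝ) (k : ℕ) : tail s (k + 1) = tail s k - s (k + 1) := by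
  simp only [tail, cum_succ]; ring

section Distribution

variable {V : ℕ} {s : ℕ → ℝ}

theorem IsStackDistribution.cum_last (hs : IsStackDistribution V s) : cum s V = 1 := by
  rw [← hs.sum_eq_one, cum, Finset.range_eq_Ico, Finset.sum_Ico_add' s 0 V 1]
  rfl

theorem IsStackDistribution.sum_fin (hs : IsStackDistribution V s) : ∑ d : Fin V, s (d + 1) = 1 := by
  rw [Fin.sum_univ_eq_sum_range (fun i => s (i + 1)) V]
  exact hs.cum_last

theorem IsStackDistribution.fin_nonneg (hs : IsStackDistribution V s) (d : Fin V) : 0 ≤ s (d + 1) :=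
  hs.nonneg _ (by omega) (by omega)

theorem IsStackDistribution.cum_mono (hs : IsStackDistribution V s) {a b : ℕ} (hab : a ≤ b) (hb : b ≤ V) :
    cum s a ≤ cum s b := by
  refine Finset.sum_le_sum_of_subset_of_nonneg (by simpa using hab) fun i hi _ => ?_
  exact hs.nonneg _ (by omega) (by simp at hi; omega)

theorem IsStackDistribution.one_le (hs : IsStackDistribution V s) : 1 ≤ V := by
  rcases Nat.eq_zero_or_pos V with rfl | h
  · have := hs.sum_eq_one
    simp at this
  · exact h

theorem IsStackDistribution.last_pos (hs : IsStackDistribution V s) : 0 < s V :=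
  lt_of_le_of_ne (hs.nonneg V hs.one_le le_rfl) hs.last_ne_zero.symm

theorem IsStackDistribution.cum_lt_one (hs : IsStackDistribution V s) {k : ℕ} (hk : k < V) : cum s k < 1 := by
  have h1 : cum s k ≤ cum s (V - 1) := hs.cum_mono (by omega) (by omega)
  have h2 : cum s V = cum s (V - 1) + s V := by
    have := cum_succ s (V - 1)
    rwa [Nat.sub_add_cancel hs.one_le] at this
  have := hs.cum_last
  have := hs.last_pos
  linarith

theorem IsStackDistribution.tail_pos (hs : IsStackDistribution V s) {k : ℕ} (hk : k < V) : 0 < tail s k := by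
  have := hs.cum_lt_one hk
  unfold tail
  linarith

theorem IsStackDistribution.tail_last (hs : IsStackDistribution V s) : tail s V = 0 := by
  simp [tail, hs.cum_last]

end Distribution

theorem cycleRange_val_of_lt {V : ℕ} {d z : Fin V} (h : z < d) :
    (Fin.cycleRange d z : ℕ) = z + 1 := Fin.coe_cycleRange_of_lt h

theorem cycleRange_val_of_gt {V : ℕ} {d z : Fin V} (h : d < z) :
    (Fin.cycleRange d z : ℕ) = z := by rw [Fin.cycleRange_of_gt h]

theorem cycleRange_val_self {V : ℕ} (d : Fin V) : (Fin.cycleRange d d : ℕ) = 0 := by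
  have : NeZero V := ⟨by have := d.2; omega⟩
  simp

/-- The expectation of `a / tail s` at the next position of an item, up to the next access. -/
theorem sum_mul_div_tail {V : ℕ} {s : ℕ → ℝ} (hs : IsStackDistribution V s) (a : ℕ → ℝ)
    (z : Fin V) :
    ∑ d : Fin V, s (d + 1) * (if d = z then 0 else
        a (Fin.cycleRange d z) / tail s (Fin.cycleRange d z)) =
      a z / tail s z - a z + if (z : ℕ) + 1 < V then a (z + 1) else 0 := by
  set A := a z / tail s z with hA
  set D := a (z + 1) / tail s (z + 1) with hD
  have h1 : ∀ d : Fin V, s (d + 1) * (if d = z then 0 else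
        a (Fin.cycleRange d z) / tail s (Fin.cycleRange d z)) =
      (fun i : ℕ => s (i + 1) * if i < z then A else if i = z then 0 else D) d := by
    intro d
    rcases lt_trichotomy d z with h | h | h
    · have h' : (d : ℕ) < z := h
      simp only [h.ne, if_false, cycleRange_val_of_gt h, h', if_true, hA]
    · simp [h]
    · have h' : ¬ (d : ℕ) < z := by have : (z : ℕ) < d := h; omega
      have h'' : ¬ (d : ℕ) = z := by have : (z : ℕ) < d := h; omega
      simp only [h.ne', if_false, cycleRange_val_of_lt h, h', h'', hD]
  rw [Finset.sum_congr rfl fun d _ => h1 d, Fin.sum_univ_eq_sum_range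
    (fun i : ℕ => s (i + 1) * if i < z then A else if i = z then 0 else D) V]
  have h2 : ∀ m, (z : ℕ) + 1 ≤ m → ∑ i ∈ range m,
      (s (i + 1) * if i < (z : ℕ) then A else if i = z then 0 else D) =
      cum s z * A + (cum s m - cum s (z + 1)) * D := by
    intro m hm
    induction m, hm using Nat.le_induction with
    | base =>
      rw [Finset.sum_range_succ, cum, Finset.sum_mul]
      simp only [lt_irrefl, if_true, if_false, mul_zero, add_zero, sub_self, zero_mul]
      exact Finset.sum_congr rfl fun i hi => by simp [Finset.mem_range.1 hi]
    | succ m hm ih =>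
      rw [Finset.sum_range_succ, ih, cum_succ s m, if_neg (by omega), if_neg (by omega)]
      ring
  rw [h2 V z.2, hs.cum_last]
  have hpos := hs.tail_pos z.2
  have e1 : cum s z * A = A - a z := by
    rw [hA]
    field_simp
    unfold tail
    ring
  rw [e1]
  split_ifs with hz
  · have := hs.tail_pos hz
    rw [hD]
    change _ + tail s (z + 1) * _ = _
    field_simp
  -- At the bottom `D` is a division by zero, but its weight vanishes.
  · have : (z : ℕ) + 1 = V := by have := z.2; omega
    rw [this, hs.cum_last]
    ring

end LRUSM

namespace LRUSM

open Finset

/-! ### The cost points of the single-item policies -/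

/-- The cost point of `ev_k`. -/
noncomputable def evPoint (V : ℕ) (s : ℕ → ℝ) (k : ℕ) : ℝ × ℝ := (k / V, tail s k / V)

theorem finSum_lt (V k : ℕ) (hk : k ≤ V) :
    ∑ z ∈ range V, (if z < k then (1 : ℝ) else 0) = k := by
  rw [Finset.sum_ite, Finset.sum_const_zero, add_zero, Finset.sum_const, nsmul_eq_mul, mul_one]
  congr 1
  rw [show (range V).filter (· < k) = range k by ext; simp; omega, Finset.card_range]

theorem tail_eq_sum {V : ℕ} {s : ℕ → ℝ} (hs : IsStackDistribution V s) {k : ℕ} (hk : k ≤ V) :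
    ∑ z ∈ range V, (if z < k then 0 else s (z + 1)) = tail s k := by
  have h : ∀ m, k ≤ m → ∑ z ∈ range m, (if z < k then 0 else s (z + 1)) =
      cum s m - cum s k := by
    intro m hm
    induction m, hm using Nat.le_induction with
    | base =>
      rw [sub_self]
      exact Finset.sum_eq_zero fun i hi => by simp [Finset.mem_range.1 hi]
    | succ m hm ih => rw [Finset.sum_range_succ, ih, cum_succ, if_neg (by omega)]; ring
  rw [h V hk, hs.cum_last, tail]

/-- A cost whose expectation depends only on the position of the item averages uniformly over
the stack. -/
theorem hasAverageCost_item {V : ℕ} [NeZero V] {s : ℕ → ℝ} (hs : IsStackDistribution V s)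
    {e : Fin V → Bool} {I : ItemState V → Prop} (hI : ∀ t x d, I x → I (itemStep e t x d))
    (h0 : I (0, true)) {g : ItemState V → Fin V → ℝ} (f : ℕ → ℝ)
    (hf : ∀ x, I x → ∑ d : Fin V, s (d + 1) * g x d = f x.1) :
    HasAverageCost s g (itemStep e) ((0, true) : ItemState V)
      ((∑ z ∈ range V, f z) / V) := by
  set G := (∑ z ∈ range V, f z) / V with hG
  have hV : (V : ℝ) ≠ 0 := by exact_mod_cast NeZero.ne V
  -- With the potential `a / tail s` the Poisson equation becomes `a (z + 1) = a z + G - f z`. The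
  -- value `a 0 = 0` accounts for the return to the top, and `a V = 0`, which fixes `G` as the mean
  -- of `f`, for the end of the stack.
  set a : ℕ → ℝ := fun z => z * G - ∑ y ∈ range z, f y with ha
  have ha0 : a 0 = 0 := by simp [ha]
  have haV : a V = 0 := by simp only [ha, hG]; field_simp; ring
  have key : ∀ t x, I x → ∑ d : Fin V, s (d + 1) * (g x d +
      (fun x : ItemState V => a x.1 / tail s x.1) (itemStep e t x d)) =
      G + (fun x : ItemState V => a x.1 / tail s x.1) x := by
    intro t x hx
    simp only [itemStep, mul_add, Finset.sum_add_distrib, hf x hx]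
    have h1 : ∀ d : Fin V, s (d + 1) *
        (a (Fin.cycleRange d x.1) / tail s (Fin.cycleRange d x.1)) =
        s (d + 1) * (if d = x.1 then 0 else
          a (Fin.cycleRange d x.1) / tail s (Fin.cycleRange d x.1)) := by
      intro d
      split_ifs with hd
      · rw [hd, cycleRange_val_self, ha0]; simp
      · rfl
    rw [Finset.sum_congr rfl fun d _ => h1 d, sum_mul_div_tail hs a x.1]
    have h2 : (if (x.1 : ℕ) + 1 < V then a (x.1 + 1) else 0) = a (x.1 + 1) := by
      split_ifs with h
      · rfl
      · rw [show (x.1 : ℕ) + 1 = V by have := x.1.2; omega, haV]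
    have h3 : a (x.1 + 1) = a x.1 + G - f x.1 := by
      simp only [ha, Finset.sum_range_succ]; push_cast; ring
    rw [h2, h3]
    ring
  exact hasAverageCost_of_le_of_ge hs.fin_nonneg hs.sum_fin hI
    (fun x : ItemState V => a x.1 / tail s x.1) (fun x : ItemState V => a x.1 / tail s x.1)
    (fun t x hx => (key t x hx).ge) (fun t x hx => (key t x hx).le) h0

/-- A policy that evicts at depth `k + 1` but at none of the depths `2, …, k` costs as much as
`ev_k`. -/
theorem hasItemCosts_of_first {V : ℕ} [NeZero V] {s : ℕ → ℝ} (hs : IsStackDistribution V s)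
    {e : Fin V → Bool} {k : ℕ} (hk1 : 1 ≤ k) (hkV : k ≤ V)
    (hlt : ∀ z : Fin V, 1 ≤ (z : ℕ) → (z : ℕ) < k → e z = false)
    (heq : ∀ z : Fin V, (z : ℕ) = k → e z = true) :
    HasItemCosts s e (evPoint V s k) := by
  -- Invariant: the item is in the buffer exactly at positions below `k`. The values of `e` at
  -- position `0` (reached only by an access) and beyond `k` (reached only when already out) play no
  -- role.
  have hI : ∀ t (x : ItemState V) d, x.2 = decide ((x.1 : ℕ) < k) →
      (itemStep e t x d).2 = decide (((itemStep e t x d).1 : ℕ) < k) := by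
    rintro t ⟨z, b⟩ d hx
    simp only at hx
    simp only [itemStep]
    rcases lt_trichotomy d z with h | h | h
    · have h' : (d : ℕ) < z := h
      rw [if_neg h.ne, cycleRange_val_of_gt h, Fin.cycleRange_of_gt h, hx]
      by_cases hz : (z : ℕ) < k
      · simp [hz, hlt z (by omega) hz]
      · simp [hz]
    · rw [if_pos h, h, cycleRange_val_self]
      simp; omega
    · have h' : (z : ℕ) < d := h
      have hv := cycleRange_val_of_lt h
      rw [if_neg h.ne', hv, hx]
      rcases lt_trichotomy ((z : ℕ) + 1) k with hz | hz | hz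
      · simp [hz, hlt (Fin.cycleRange d z) (by omega) (by omega)]; omega
      · simp [heq (Fin.cycleRange d z) (by omega)]; omega
      · have : ¬ (z : ℕ) < k := by omega
        simp [this]; omega
  have h0 : ((0, true) : ItemState V).2 = decide ((((0, true) : ItemState V).1 : ℕ) < k) :=
    (decide_eq_true (by simpa using (show 0 < k from hk1))).symm
  constructor
  · have := hasAverageCost_item hs (e := e) (g := itemOccupancy) hI h0
      (fun z => if z < k then (1 : ℝ) else 0) (by
        intro x hx
        simp only [itemOccupancy, hx, decide_eq_true_eq]
        rw [← Finset.sum_mul, hs.sum_fin, one_mul])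
    rwa [finSum_lt V k hkV] at this
  · have := hasAverageCost_item hs (e := e) (g := itemMiss) hI h0
      (fun z => if z < k then (0 : ℝ) else s (z + 1)) (by
        intro x hx
        simp only [itemMiss, hx, decide_eq_false_iff_not]
        by_cases hz : (x.1 : ℕ) < k
        · simp [hz]
        · simp [hz])
    rwa [tail_eq_sum hs hkV] at this

theorem hasItemCosts_ev {V : ℕ} [NeZero V] {s : ℕ → ℝ} (hs : IsStackDistribution V s) {k : ℕ}
    (hk1 : 1 ≤ k) (hkV : k ≤ V) : HasItemCosts (V := V) s (evPolicy k) (evPoint V s k) :=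
  hasItemCosts_of_first hs hk1 hkV (fun z _ h => by simp [evPolicy]; omega)
    (fun z h => by simp [evPolicy]; omega)

theorem HasItemCosts.unique {V : ℕ} [NeZero V] {s : ℕ → ℝ} {e : Fin V → Bool} {p p' : ℝ × ℝ}
    (h : HasItemCosts s e p) (h' : HasItemCosts s e p') : p = p' :=
  Prod.ext (tendsto_nhds_unique h.1 h'.1) (tendsto_nhds_unique h.2 h'.2)

/-- Only the least position `k ≥ 1` at which `e` evicts matters; `k = V` stands for no such
position. -/
theorem itemCostPoints_eq {V : ℕ} [NeZero V] {s : ℕ → ℝ} (hs : IsStackDistribution V s) :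
    itemCostPoints V s = {p | ∃ k, 1 ≤ k ∧ k ≤ V ∧ p = evPoint V s k} := by
  ext p
  constructor
  · rintro ⟨e, he⟩
    have hex : ∃ k, 1 ≤ k ∧ (k = V ∨ ∃ z : Fin V, (z : ℕ) = k ∧ e z = true) :=
      ⟨V, hs.one_le, Or.inl rfl⟩
    classical
    have hmin : ∀ m, m < Nat.find hex → _ := fun m hm => Nat.find_min hex hm
    obtain ⟨h1, h2⟩ := Nat.find_spec hex
    have hV : Nat.find hex ≤ V := Nat.find_min' hex ⟨hs.one_le, Or.inl rfl⟩
    refine ⟨Nat.find hex, h1, hV, he.unique (hasItemCosts_of_first hs h1 hV ?_ ?_)⟩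
    · intro z hz1 hz
      by_contra hne
      exact hmin z hz ⟨hz1, Or.inr ⟨z, rfl, by simpa using hne⟩⟩
    · intro z hz
      rcases h2 with h2 | ⟨y, hy, hey⟩
      · have := z.2; omega
      · rwa [show z = y from Fin.ext (hz.trans hy.symm)]
  · rintro ⟨k, h1, h2, rfl⟩
    exact ⟨_, hasItemCosts_ev hs h1 h2⟩

theorem evPoint_mem {V : ℕ} [NeZero V] {s : ℕ → ℝ} (hs : IsStackDistribution V s) {k : ℕ}
    (hk1 : 1 ≤ k) (hkV : k ≤ V) : evPoint V s k ∈ itemCostPoints V s := by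
  rw [itemCostPoints_eq hs]
  exact ⟨k, hk1, hkV, rfl⟩

theorem evPoint_injective (V : ℕ) [NeZero V] (s : ℕ → ℝ) : Function.Injective (evPoint V s) := by
  intro a b h
  have hV : (V : ℝ) ≠ 0 := by exact_mod_cast NeZero.ne V
  have h1 := congrArg Prod.fst h
  simp only [evPoint] at h1
  rw [div_left_inj' hV] at h1
  exact_mod_cast h1

/-! ### Supporting lines, efficiency and the average-occupancy optimum -/

theorem convex_halfspace_lt (l c : ℝ) : Convex ℝ {p : ℝ × ℝ | c < p.2 + l * p.1} := by
  intro x hx y hy a b ha hb hab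
  simp only [Set.mem_ofPred_eq, Prod.snd_add, Prod.fst_add, Prod.smul_snd, Prod.smul_fst,
    smul_eq_mul] at *
  have e : a * x.2 + b * y.2 + l * (a * x.1 + b * y.1) - c =
    a * (x.2 + l * x.1 - c) + b * (y.2 + l * y.1 - c) := by
    rw [show c = (a + b) * c by rw [hab, one_mul]]
    ring_nf
    rw [show b = 1 - a by linarith]
    ring
  rcases ha.eq_or_lt with rfl | ha
  · have hb1 : b = 1 := by linarith
    subst hb1
    linarith
  · have := mul_pos ha (sub_pos.2 hx)
    have := mul_nonneg hb (sub_pos.2 hy).le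
    linarith

theorem convex_halfspace_le (l c : ℝ) : Convex ℝ {p : ℝ × ℝ | c ≤ p.2 + l * p.1} := by
  intro x hx y hy a b ha hb hab
  simp only [Set.mem_ofPred_eq, Prod.snd_add, Prod.fst_add, Prod.smul_snd, Prod.smul_fst,
    smul_eq_mul] at *
  have := mul_nonneg ha (sub_nonneg.2 hx)
  have := mul_nonneg hb (sub_nonneg.2 hy)
  have e : c = a * c + b * c := by rw [← add_mul, hab, one_mul]
  linarith

/-- A vertex of the hull, witnessed by a strictly supporting line, is supported efficient. -/
theorem isSupportedEv_of_lt {V : ℕ} [NeZero V] {s : ℕ → ℝ} (hs : IsStackDistribution V s) {k : ℕ}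
    (hk1 : 1 ≤ k) (hkV : k ≤ V) {l : ℝ} (hl : 0 ≤ l)
    (h : ∀ z, 1 ≤ z → z ≤ V → z ≠ k → tail s k + l * k < tail s z + l * z) :
    IsSupportedEv V s k := by
  refine ⟨_, hasItemCosts_ev hs hk1 hkV, ?_⟩
  rintro ⟨y, hy, hle⟩
  have hV : (0 : ℝ) < V := by exact_mod_cast hs.one_le
  have hsub : itemCostPoints V s \ {evPoint V s k} ⊆
      {p : ℝ × ℝ | (tail s k + l * k) / V < p.2 + l * p.1} := by
    rintro p ⟨hp, hne⟩
    rw [itemCostPoints_eq hs] at hp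
    obtain ⟨z, h1, h2, rfl⟩ := hp
    have hzk : z ≠ k := by rintro rfl; exact hne rfl
    have := h z h1 h2 hzk
    simp only [evPoint, Set.mem_ofPred_eq]
    rw [← mul_div_assoc, ← add_div]
    exact div_lt_div_of_pos_right this hV
  have h1 := convexHull_min hsub (convex_halfspace_lt _ _) hy
  simp only [Set.mem_ofPred_eq] at h1
  have h2 : y.1 ≤ k / V := hle.1
  have h3 : y.2 ≤ tail s k / V := hle.2
  have h4 := mul_le_mul_of_nonneg_left h2 hl
  rw [add_div, mul_div_assoc] at h1
  linarith

/-- Weights of a point on a segment. -/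
theorem exists_weights {K k L : ℝ} (h1 : K < k) (h2 : k ≤ L) :
    ∃ a b : ℝ, 0 ≤ a ∧ 0 ≤ b ∧ a + b = 1 ∧ a * K + b * L = k :=
  have h : L - K ≠ 0 := by linarith
  ⟨(L - k) / (L - K), (k - K) / (L - K), div_nonneg (by linarith) (by linarith),
    div_nonneg (by linarith) (by linarith), by field_simp; ring, by field_simp; ring⟩

/-- The chord from the point of `K` to that of `L` passes, above the abscissa of `k`, at or below
the point of `k`. -/
theorem not_isSupportedEv_of_le {V : ℕ} [NeZero V] {s : ℕ → ℝ} (hs : IsStackDistribution V s)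
    {K k L : ℕ} (hK : 1 ≤ K) (hKk : K < k) (hkL : k < L) (hL : L ≤ V) {l w : ℝ}
    (eK : tail s K + l * K = w) (eL : tail s L + l * L = w) (hk : w ≤ tail s k + l * k) :
    ¬ IsSupportedEv V s k := by
  rintro ⟨p, hp, hno⟩
  have hV : (0 : ℝ) < V := by exact_mod_cast hs.one_le
  obtain rfl := hp.unique (hasItemCosts_ev hs (by omega) (by omega))
  obtain ⟨a, b, ha, hb, hab, hc⟩ := exists_weights (K := K) (k := k) (L := L)
    (by exact_mod_cast hKk) (by exact_mod_cast hkL.le)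
  have mK : evPoint V s K ∈ itemCostPoints V s \ {evPoint V s k} :=
    ⟨evPoint_mem hs hK (by omega), fun h => hKk.ne (evPoint_injective V s h)⟩
  have mL : evPoint V s L ∈ itemCostPoints V s \ {evPoint V s k} :=
    ⟨evPoint_mem hs (by omega) hL, fun h => hkL.ne' (evPoint_injective V s h)⟩
  refine hno ⟨a • evPoint V s K + b • evPoint V s L,
    (convex_convexHull ℝ _) (subset_convexHull ℝ _ mK) (subset_convexHull ℝ _ mL) ha hb hab, ?_⟩
  · constructor
    · simp only [evPoint, Prod.smul_mk, Prod.mk_add_mk, smul_eq_mul]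
      rw [← mul_div_assoc, ← mul_div_assoc, ← add_div, hc]
    · simp only [evPoint, Prod.smul_mk, Prod.mk_add_mk, smul_eq_mul]
      rw [← mul_div_assoc, ← mul_div_assoc, ← add_div]
      refine div_le_div_of_nonneg_right ?_ hV.le
      have : a * tail s K + b * tail s L = w - l * k := by
        rw [← hc, ← one_mul w, ← hab, ← eK]
        have e : b * tail s L = b * (tail s K + l * K - l * L) := by rw [eK, ← eL]; ring
        rw [e]; ring
      linarith

/-- The average-occupancy optimum, from a supporting line that touches the hull at the ends of
a segment around `C`. -/
theorem isAverageOccupancyOptimum_of_support {V : ℕ} [NeZero V] {s : ℕ → ℝ}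
    (hs : IsStackDistribution V s) {K C L : ℕ} (hKC : K < C) (hCL : C ≤ L) (hL : L ≤ V)
    (hK0 : K = 0 → L = 1) {l w : ℝ}
    (hw : ∀ z, 1 ≤ z → z ≤ V → w ≤ tail s z + l * z)
    (eK : 1 ≤ K → tail s K + l * K = w) (eL : tail s L + l * L = w) :
    IsAverageOccupancyOptimum V s C (w - l * C) := by
  have hV : (0 : ℝ) < V := by exact_mod_cast hs.one_le
  constructor
  · by_cases hK : 1 ≤ K
    · obtain ⟨a, b, ha, hb, hab, hc⟩ := exists_weights (K := K) (k := C) (L := L)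
        (by exact_mod_cast hKC) (by exact_mod_cast hCL)
      refine ⟨a • evPoint V s K + b • evPoint V s L,
        (convex_convexHull ℝ _) (subset_convexHull ℝ _ (evPoint_mem hs hK (by omega)))
          (subset_convexHull ℝ _ (evPoint_mem hs (by omega) hL)) ha hb hab, ?_, ?_⟩
      · simp only [evPoint, Prod.smul_mk, Prod.mk_add_mk, smul_eq_mul]
        rw [← hc]; field_simp
      · simp only [evPoint, Prod.smul_mk, Prod.mk_add_mk, smul_eq_mul]
        have e1 : tail s K = w - l * K := by linarith [eK hK]
        have e2 : tail s L = w - l * L := by linarith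
        rw [e1, e2, ← hc]
        field_simp
        rw [show b = 1 - a by linarith]
        ring
    · have hL1 : L = 1 := hK0 (by omega)
      have hC : C = L := by omega
      subst hC
      refine ⟨evPoint V s C, subset_convexHull ℝ _ (evPoint_mem hs (by omega) hL), ?_, ?_⟩
      · simp only [evPoint]; field_simp
      · simp only [evPoint]; field_simp; linarith
  · rintro m ⟨p, hp, h1, rfl⟩
    have hsub : itemCostPoints V s ⊆ {p : ℝ × ℝ | w / V ≤ p.2 + l * p.1} := by
      intro p hp
      rw [itemCostPoints_eq hs] at hp
      obtain ⟨z, h1, h2, rfl⟩ := hp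
      simp only [evPoint, Set.mem_ofPred_eq]
      rw [← mul_div_assoc, ← add_div]
      exact div_le_div_of_nonneg_right (hw z h1 h2) hV.le
    have h2 := convexHull_min hsub (convex_halfspace_le _ _) hp
    simp only [Set.mem_ofPred_eq] at h2
    rw [div_le_iff₀ hV] at h2
    rw [← h1]
    linarith

end LRUSM

namespace LRUSM

open Finset

/-! ### The concave hull of the cumulated distribution -/

/-- The average of `s (m + 1), …, s e`. -/
noncomputable def slope (s : ℕ → ℝ) (m e : ℕ) : ℝ := (cum s e - cum s m) / ((e : ℝ) - m)

theorem cum_eq_add_slope (s : ℕ → ℝ) {m e : ℕ} (h : m < e) :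
    cum s e = cum s m + slope s m e * ((e : ℝ) - m) := by
  have : ((e : ℝ) - m) ≠ 0 := by
    have : (m : ℝ) < e := by exact_mod_cast h
    linarith
  unfold slope
  field_simp
  ring

/-- Among `m + 1, …, e`, the slope from `m` is greatest at `e`. -/
structure IsPrefixMax (V : ℕ) (s : ℕ → ℝ) (m e : ℕ) : Prop where
  lt : m < e
  le : e ≤ V
  cum_le : ∀ n, m < n → n ≤ e → cum s n ≤ cum s m + slope s m e * ((n : ℝ) - m)

/-- The slope from `m` is greatest at `e`, and `e` is the last such point. -/
structure IsNext (V : ℕ) (s : ℕ → ℝ) (m e : ℕ) : Prop where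
  lt : m < e
  le : e ≤ V
  cum_le : ∀ n, m < n → n ≤ V → cum s n ≤ cum s m + slope s m e * ((n : ℝ) - m)
  cum_lt : ∀ n, e < n → n ≤ V → cum s n < cum s m + slope s m e * ((n : ℝ) - m)

/-- The list of the vertices to the right of `m` of the concave hull of `cum s` on `[m, V]`. -/
inductive HullChain (V : ℕ) (s : ℕ → ℝ) : ℕ → List ℕ → Prop
  | last : HullChain V s V []
  | cons {m e : ℕ} {l : List ℕ} : IsNext V s m e → HullChain V s e l → HullChain V s m (e :: l)

section Hull

variable {V : ℕ} {s : ℕ → ℝ}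

theorem isPrefixMax_succ {m : ℕ} (h : m < V) : IsPrefixMax V s m (m + 1) where
  lt := by omega
  le := by omega
  cum_le n h1 h2 := by
    obtain rfl : n = m + 1 := by omega
    exact (cum_eq_add_slope s h1).le

/-- The slope from `m` to `f` is a mean of those of the two pieces, so it lies between them. Up to
`e` the line from `m` therefore only gets steeper; beyond `e`, the line through the point at `f` is
lowered in slope, which raises it to the left of `f`. -/
theorem IsPrefixMax.merge {m e f : ℕ} (h : IsPrefixMax V s m e) (hf : IsNext V s e f)
    (hle : slope s m e ≤ slope s e f) : IsPrefixMax V s m f where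
  lt := h.lt.trans hf.lt
  le := hf.le
  cum_le n h1 h2 := by
    have a1 : (m : ℝ) < e := by exact_mod_cast h.lt
    have a2 : (e : ℝ) < f := by exact_mod_cast hf.lt
    have e1 := cum_eq_add_slope s h.lt
    have e2 := cum_eq_add_slope s hf.lt
    have e3 := cum_eq_add_slope s (h.lt.trans hf.lt)
    have b1 : slope s m e ≤ slope s m f := by
      by_contra hc
      push Not at hc
      nlinarith
    have b2 : slope s m f ≤ slope s e f := by
      by_contra hc
      push Not at hc
      nlinarith
    rcases le_or_gt n e with hn | hn
    · have c1 := h.cum_le n h1 hn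
      have c2 : (m : ℝ) < n := by exact_mod_cast h1
      nlinarith
    · have c1 := hf.cum_le n hn (h2.trans hf.le)
      have c2 : (n : ℝ) ≤ f := by exact_mod_cast h2
      nlinarith

/-- To the right of `e` the graph stays below a line through `e` of slope less than `slope s m e`,
so no later point can be as steep as `e` from `m`. -/
theorem IsPrefixMax.isNext_of_lt {m e f : ℕ} (h : IsPrefixMax V s m e) (hf : IsNext V s e f)
    (hlt : slope s e f < slope s m e) : IsNext V s m e := by
  have key : ∀ n, e < n → n ≤ V → cum s n < cum s m + slope s m e * ((n : ℝ) - m) := by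
    intro n h1 h2
    have e1 := cum_eq_add_slope s h.lt
    have c1 := hf.cum_le n h1 h2
    have c2 : (e : ℝ) < n := by exact_mod_cast h1
    nlinarith
  refine ⟨h.lt, h.le, fun n h1 h2 => ?_, key⟩
  rcases le_or_gt n e with hn | hn
  · exact h.cum_le n h1 hn
  · exact (key n hn h2).le

theorem IsPrefixMax.isNext_last {m : ℕ} (h : IsPrefixMax V s m V) : IsNext V s m V :=
  ⟨h.lt, h.le, h.cum_le, fun n h1 h2 => by omega⟩

/-- The inner loop of the scan, without the store: blocks are absorbed until the next slope is
strictly smaller. -/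
theorem exists_isNext {e : ℕ} {l : List ℕ} (hl : HullChain V s e l) {m : ℕ}
    (h : IsPrefixMax V s m e) : ∃ e' l', IsNext V s m e' ∧ HullChain V s e' l' := by
  induction hl with
  | last => exact ⟨V, [], h.isNext_last, .last⟩
  | @cons e f l hf hl ih =>
    rcases le_or_gt (slope s m e) (slope s e f) with hle | hlt
    · exact ih (h.merge hf hle)
    · exact ⟨e, f :: l, h.isNext_of_lt hf hlt, .cons hf hl⟩

theorem exists_hullChain {m : ℕ} (hm : m ≤ V) : ∃ l, HullChain V s m l := by
  induction hm using Nat.decreasingInduction with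
  | self => exact ⟨[], .last⟩
  | of_succ m hm ih =>
    obtain ⟨l, hl⟩ := ih
    obtain ⟨e, l', he, hl'⟩ := exists_isNext hl (isPrefixMax_succ hm)
    exact ⟨e :: l', .cons he hl'⟩

theorem IsNext.unique {m e f : ℕ} (he : IsNext V s m e) (hf : IsNext V s m f) : e = f := by
  wlog hlt : e < f generalizing e f
  · rcases Nat.lt_trichotomy e f with h | h | h
    · exact this he hf h
    · exact h
    · exact (this hf he h).symm
  have h1 := he.cum_lt f hlt hf.le
  have h2 := hf.cum_le e he.lt he.le
  rw [cum_eq_add_slope s hf.lt] at h1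
  rw [cum_eq_add_slope s he.lt] at h2
  have a1 : (m : ℝ) < e := by exact_mod_cast he.lt
  have a2 : (m : ℝ) < f := by exact_mod_cast hf.lt
  nlinarith

theorem HullChain.eq_nil {l : List ℕ} (h : HullChain V s V l) : l = [] := by
  cases h with
  | last => rfl
  | cons he _ => exact absurd he.lt (by have := he.le; omega)

theorem HullChain.unique {m : ℕ} {l l' : List ℕ} (h : HullChain V s m l)
    (h' : HullChain V s m l') : l = l' := by
  induction h generalizing l' with
  | last => exact h'.eq_nil.symm
  | cons he hl ih =>
    cases h' with
    | last => exact absurd he.lt (by have := he.le; omega)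
    | cons he' hl' =>
      obtain rfl := he.unique he'
      rw [ih hl']

theorem HullChain.le_of_mem {m : ℕ} {l : List ℕ} (h : HullChain V s m l) :
    ∀ k ∈ m :: l, m ≤ k ∧ k ≤ V := by
  induction h with
  | last => simp
  | cons he _ ih =>
    intro k hk
    rcases List.mem_cons.1 hk with rfl | hk
    · exact ⟨le_rfl, he.lt.le.trans he.le⟩
    · have := ih k hk
      have := he.lt
      omega

theorem HullChain.pairwise {m : ℕ} {l : List ℕ} (h : HullChain V s m l) :
    (m :: l).Pairwise (· < ·) := by
  induction h with
  | last => simp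
  | cons he hl ih =>
    refine List.pairwise_cons.2 ⟨fun k hk => ?_, ih⟩
    have := hl.le_of_mem k hk
    have := he.lt
    omega

theorem HullChain.getLast? {m : ℕ} {l : List ℕ} (h : HullChain V s m l) :
    (m :: l).getLast? = some V := by
  induction h with
  | last => rfl
  | cons he hl ih => rw [List.getLast?_cons_cons, ih]

/-! ### Hull vertices as efficient policies -/

/-- A block that ends at `V` has positive average because `s V > 0`; this is why the sentinel of
ratio `0` stops the merging. -/
theorem slope_last_pos (hs : IsStackDistribution V s) {m : ℕ} (h : m < V) : 0 < slope s m V := by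
  have h1 := hs.cum_lt_one h
  have h2 : (m : ℝ) < V := by exact_mod_cast h
  rw [slope, hs.cum_last]
  exact div_pos (by linarith) (by linarith)

theorem IsNext.slope_pos (hs : IsStackDistribution V s) {m e : ℕ} (h : IsNext V s m e) :
    0 < slope s m e := by
  have hV : m < V := h.lt.trans_le h.le
  have h1 := h.cum_le V hV le_rfl
  have h3 := hs.cum_lt_one hV
  have h2 : (m : ℝ) < V := by exact_mod_cast hV
  rw [hs.cum_last] at h1
  by_contra hc
  push Not at hc
  nlinarith

/-- `m` is a vertex of the concave hull of `cum s` on `[1, V]`: a line of slope `r > 0` through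
`m` supports it from the left and lies strictly above it on the right. -/
structure IsVertexSlope (V : ℕ) (s : ℕ → ℝ) (m : ℕ) (r : ℝ) : Prop where
  one_le : 1 ≤ m
  le : m ≤ V
  pos : 0 < r
  cum_le : ∀ z, 1 ≤ z → z < m → cum s z ≤ cum s m + r * ((z : ℝ) - m)
  cum_lt : ∀ z, m < z → z ≤ V → cum s z < cum s m + r * ((z : ℝ) - m)

/-- For `z ≥ 2` one has `cum s z ≤ 1 < 2 * (z - 1)`, and `cum s 1 ≥ 0`; any slope above `1` would
do. -/
theorem isVertexSlope_one (hs : IsStackDistribution V s) : IsVertexSlope V s 1 2 where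
  one_le := le_rfl
  le := hs.one_le
  pos := by norm_num
  cum_le z h1 h2 := by omega
  cum_lt z h1 h2 := by
    have h3 := hs.cum_mono h2 le_rfl
    have h4 := hs.cum_mono (Nat.zero_le 1) hs.one_le
    rw [hs.cum_last] at h3
    rw [cum_zero] at h4
    have h5 : (2 : ℝ) ≤ z := by exact_mod_cast h1
    push_cast
    linarith

theorem IsVertexSlope.slope_lt {m e : ℕ} {r : ℝ} (h : IsVertexSlope V s m r)
    (he : IsNext V s m e) : slope s m e < r := by
  have h1 := h.cum_lt e he.lt he.le
  rw [cum_eq_add_slope s he.lt] at h1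
  have a1 : (m : ℝ) < e := by exact_mod_cast he.lt
  by_contra hc
  push Not at hc
  nlinarith

/-- Turning the line about `m` from slope `r` to the smaller slope of the next edge raises it on the
left; on the right `IsNext` applies. -/
theorem IsVertexSlope.support {m e : ℕ} {r : ℝ} (h : IsVertexSlope V s m r)
    (he : IsNext V s m e) (z : ℕ) (h1 : 1 ≤ z) (h2 : z ≤ V) :
    cum s z ≤ cum s m + slope s m e * ((z : ℝ) - m) := by
  rcases lt_trichotomy z m with hz | rfl | hz
  · have := h.cum_le z h1 hz
    have := h.slope_lt he
    have : (z : ℝ) < m := by exact_mod_cast hz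
    nlinarith
  · simp
  · exact he.cum_le z hz h2

theorem IsVertexSlope.next (hs : IsStackDistribution V s) {m e : ℕ} {r : ℝ}
    (h : IsVertexSlope V s m r) (he : IsNext V s m e) : IsVertexSlope V s e (slope s m e) where
  one_le := h.one_le.trans he.lt.le
  le := he.le
  pos := he.slope_pos hs
  cum_le z h1 h2 := by
    have := h.support he z h1 (h2.le.trans he.le)
    have := cum_eq_add_slope s he.lt
    linarith
  cum_lt z h1 h2 := by
    have := he.cum_lt z h1 h2
    have := cum_eq_add_slope s he.lt
    linarith

theorem IsVertexSlope.isSupportedEv [NeZero V] (hs : IsStackDistribution V s) {m : ℕ} {r : ℝ}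
    {l : List ℕ} (h : IsVertexSlope V s m r) (hl : HullChain V s m l) : IsSupportedEv V s m := by
  -- `r'` is the slope of the next edge, or `0` at `V`. Slope `r` works to the left of `m` and `r'`
  -- to the right; their midpoint is strictly between, so it supports strictly on both sides.
  obtain ⟨r', h0, hr, hr'⟩ : ∃ r', 0 ≤ r' ∧ r' < r ∧
      ∀ z, m < z → z ≤ V → cum s z ≤ cum s m + r' * ((z : ℝ) - m) := by
    cases hl with
    | last => exact ⟨0, le_rfl, h.pos, fun z h1 h2 => by omega⟩
    | cons he _ => exact ⟨_, (he.slope_pos hs).le, h.slope_lt he, he.cum_le⟩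
  refine isSupportedEv_of_lt hs h.one_le h.le (l := (r + r') / 2) (by linarith) ?_
  intro z h1 h2 hne
  unfold tail
  rcases lt_or_gt_of_ne hne with hz | hz
  · have := h.cum_le z h1 hz
    have : (z : ℝ) < m := by exact_mod_cast hz
    nlinarith
  · have := hr' z hz h2
    have : (m : ℝ) < z := by exact_mod_cast hz
    nlinarith

theorem IsVertexSlope.tail_support {m e : ℕ} {r : ℝ} (h : IsVertexSlope V s m r)
    (he : IsNext V s m e) (z : ℕ) (h1 : 1 ≤ z) (h2 : z ≤ V) :
    tail s m + slope s m e * m ≤ tail s z + slope s m e * z := by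
  have := h.support he z h1 h2
  unfold tail
  linarith

theorem IsNext.tail_eq {m e : ℕ} (he : IsNext V s m e) :
    tail s e + slope s m e * e = tail s m + slope s m e * m := by
  have := cum_eq_add_slope s he.lt
  unfold tail
  linarith

/-- From a vertex on, the list of the hull vertices is that of the supported efficient policies. -/
theorem HullChain.mem_iff_isSupportedEv [NeZero V] (hs : IsStackDistribution V s) {m : ℕ}
    {l : List ℕ} (hl : HullChain V s m l) {r : ℝ} (h : IsVertexSlope V s m r) {k : ℕ}
    (hk : m ≤ k) (hkV : k ≤ V) : k ∈ m :: l ↔ IsSupportedEv V s k := by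
  induction hl generalizing r with
  | last =>
    obtain rfl : k = V := by omega
    simp [h.isSupportedEv hs .last]
  | @cons m e l he hl ih =>
    rcases hk.eq_or_lt with rfl | hmk
    · simp [h.isSupportedEv hs (.cons he hl)]
    rw [List.mem_cons, or_iff_right hmk.ne']
    rcases lt_or_ge k e with hke | hke
    · refine iff_of_false (fun hmem => ?_) ?_
      · have := hl.le_of_mem k hmem
        omega
      · exact not_isSupportedEv_of_le hs h.one_le hmk hke he.le rfl he.tail_eq
          (h.tail_support he k (h.one_le.trans hk) hkV)
    · exact ih (h.next hs he) hke

/-- The line of slope `-r` through `(L, tail s L)` and, if `K ≠ 0`, through `(K, tail s K)`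
supports the miss rates from below; `w` is its height at `0`. -/
structure IsSupportingLine (V : ℕ) (s : ℕ → ℝ) (K L : ℕ) (r w : ℝ) : Prop where
  nonneg : 0 ≤ r
  le : ∀ z, 1 ≤ z → z ≤ V → w ≤ tail s z + r * z
  left : 1 ≤ K → tail s K + r * K = w
  right : tail s L + r * L = w

/-- The pair is the edge over `C`. A later pair starts at `K' ≥ e ≥ C`, an earlier one ends before
`C`. -/
theorem HullChain.exists_pair (hs : IsStackDistribution V s) {m : ℕ}
    {l : List ℕ} (hl : HullChain V s m l) {r : ℝ} (h : IsVertexSlope V s m r) {C : ℕ}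
    (hC : m < C) (hCV : C ≤ V) :
    ∃ K L, (∀ K' L', ([K', L'] <:+: m :: l ∧ K' < C ∧ C ≤ L') ↔ K' = K ∧ L' = L) ∧
      1 ≤ K ∧ K < C ∧ C ≤ L ∧ L ≤ V ∧ ∃ r w, IsSupportingLine V s K L r w := by
  induction hl generalizing r with
  | last => omega
  | @cons m e l he hl ih =>
    rcases le_or_gt C e with hCe | hCe
    · refine ⟨m, e, fun K' L' => ⟨?_, ?_⟩, h.one_le, hC, hCe, he.le, slope s m e, _,
        (he.slope_pos hs).le, h.tail_support he, fun _ => rfl, he.tail_eq⟩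
      · rintro ⟨h1, h2, h3⟩
        rcases List.infix_cons_iff.1 h1 with h1 | h1
        · simpa using h1
        · have := hl.le_of_mem K' (h1.subset (by simp))
          omega
      · rintro ⟨rfl, rfl⟩
        exact ⟨List.IsPrefix.isInfix ⟨l, rfl⟩, hC, hCe⟩
    · obtain ⟨K, L, h1, h2⟩ := ih (h.next hs he) hCe
      refine ⟨K, L, fun K' L' => ?_, h2⟩
      rw [← h1 K' L', List.infix_cons_iff]
      constructor
      · rintro ⟨h3 | h3, h4, h5⟩
        · obtain ⟨rfl, rfl⟩ : K' = m ∧ L' = e := by simpa using h3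
          omega
        · exact ⟨h3, h4, h5⟩
      · rintro ⟨h3, h4, h5⟩
        exact ⟨Or.inr h3, h4, h5⟩

theorem exists_pair_zero_cons (hs : IsStackDistribution V s) {l : List ℕ}
    (hl : HullChain V s 1 l) {C : ℕ} (hC : 1 ≤ C) (hCV : C ≤ V) :
    ∃ K L, (∀ K' L', ([K', L'] <:+: 0 :: 1 :: l ∧ K' < C ∧ C ≤ L') ↔ K' = K ∧ L' = L) ∧
      (K = 0 → L = 1) ∧ K < C ∧ C ≤ L ∧ L ≤ V ∧ ∃ r w, IsSupportingLine V s K L r w := by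
  rcases hC.eq_or_lt with rfl | hC
  -- For `C = 1` the line need only touch at `1`, so the slope `2` of `isVertexSlope_one` serves.
  · refine ⟨0, 1, fun K' L' => ⟨?_, ?_⟩, fun _ => rfl, by omega, le_rfl, hCV, 2, _,
      by norm_num, fun z h1 h2 => ?_, by omega, rfl⟩
    · rintro ⟨h1, h2, h3⟩
      rcases List.infix_cons_iff.1 h1 with h1 | h1
      · simpa using h1
      · have := hl.le_of_mem K' (h1.subset (by simp))
        omega
    · rintro ⟨rfl, rfl⟩
      exact ⟨List.IsPrefix.isInfix ⟨l, rfl⟩, by omega, le_rfl⟩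
    · rcases h1.eq_or_lt with rfl | h1
      · exact le_rfl
      · have := (isVertexSlope_one hs).cum_lt z h1 h2
        unfold tail
        linarith
  · obtain ⟨K, L, h1, h2, h3⟩ := hl.exists_pair hs (isVertexSlope_one hs) hC hCV
    refine ⟨K, L, fun K' L' => ?_, by omega, h3⟩
    rw [← h1 K' L', List.infix_cons_iff]
    constructor
    · rintro ⟨h3 | h3, h4, h5⟩
      · obtain ⟨rfl, rfl⟩ : K' = 0 ∧ L' = 1 := by simpa using h3
        omega
      · exact ⟨h3, h4, h5⟩
    · rintro ⟨h3, h4, h5⟩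
      exact ⟨Or.inr h3, h4, h5⟩

end Hull

end LRUSM

namespace LRUSM

open Finset

/-! ### The fixed capacity problem -/

instance (V : ℕ) : Finite (BufferState V) :=
  Finite.of_injective (fun x : BufferState V => (x.stack, x.buffer)) fun x y h => by
    cases x; cases y; simpa using h

/-! ### The potential of the rented buffer -/

section Potential

variable {V : ℕ} {s : ℕ → ℝ} {K L C : ℕ} {r w : ℝ}

/-- Relative value of an item at position `z`, in the buffer or not, when a unit of occupancy
costs `r` and the optimal cost of an item is `w / V`. -/
noncomputable def itemValue (V : ℕ) (s : ℕ → ℝ) (r w : ℝ) (z : ℕ) (b : Prop) [Decidable b] : ℝ :=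
  if b then z * (w / V - r) / tail s z else (tail s z - (V - z) * (w / V)) / tail s z

/-- The sum of the relative values of all the items. -/
noncomputable def bufferValue (s : ℕ → ℝ) (r w : ℝ) (x : BufferState V) : ℝ :=
  ∑ z : Fin V, itemValue V s r w z (x.stack z ∈ x.buffer)

theorem itemValue_true (z : ℕ) {b : Prop} [Decidable b] (hb : b) :
    itemValue V s r w z b = z * (w / V - r) / tail s z := if_pos hb

theorem itemValue_false (z : ℕ) {b : Prop} [Decidable b] (hb : ¬ b) :
    itemValue V s r w z b = (tail s z - (V - z) * (w / V)) / tail s z := if_neg hb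

theorem bufferValue_step (μ : Policy V) (t : ℕ) (x : BufferState V) (d : Fin V) :
    bufferValue s r w (bufferStep μ t x d) =
      ∑ z : Fin V, itemValue V s r w (Fin.cycleRange d z)
        (x.stack z ∈ (bufferStep μ t x d).buffer) := by
  unfold bufferValue
  rw [← Equiv.sum_comp (Fin.cycleRange d)]
  refine Finset.sum_congr rfl fun z _ => ?_
  have : (bufferStep μ t x d).stack (Fin.cycleRange d z) = x.stack z := by
    simp [bufferStep, rotate]
  simp only [this]

theorem bufferMiss_eq_sum (x : BufferState V) (d : Fin V) :
    bufferMiss x d = ∑ z : Fin V, if d = z ∧ x.stack z ∉ x.buffer then (1 : ℝ) else 0 := by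
  rw [Finset.sum_eq_single d]
  · simp only [bufferMiss, true_and]
    split_ifs <;> simp_all
  · intro z _ hz
    rw [if_neg fun h => hz h.1.symm]
  · simp

theorem sum_mem_buffer (x : BufferState V) :
    ∑ z : Fin V, (if x.stack z ∈ x.buffer then r else 0) = r * x.buffer.card := by
  rw [Equiv.sum_comp x.stack (fun j => if j ∈ x.buffer then r else 0), Finset.sum_ite_mem,
    Finset.univ_inter, Finset.sum_const, nsmul_eq_mul, mul_comm]

theorem mem_bufferStep_iff (μ : Policy V) (t : ℕ) (x : BufferState V) {d z : Fin V}
    (h : d ≠ z) : x.stack z ∈ (bufferStep μ t x d).buffer ↔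
      x.stack z ∈ x.buffer ∧ μ t x d ≠ some (x.stack z) := by
  have : x.stack z ≠ x.stack d := fun h' => h (x.stack.injective h').symm
  simp [bufferStep, this]

theorem self_mem_bufferStep (μ : Policy V) (t : ℕ) (x : BufferState V) (d : Fin V) :
    x.stack d ∈ (bufferStep μ t x d).buffer := by
  simp [bufferStep]

/-- An item that is not accessed ends below the top, where the supporting-line inequality is
available. -/
theorem one_le_cycleRange {d z : Fin V} (h : d ≠ z) : 1 ≤ (Fin.cycleRange d z : ℕ) := by
  rcases lt_or_gt_of_ne h with h | h
  · rw [cycleRange_val_of_gt h]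
    have : (d : ℕ) < z := h
    omega
  · rw [cycleRange_val_of_lt h]
    omega

/-- Linearity of expectation decouples the items: the position of each one evolves by itself, and
the policy enters only through membership in the buffer. -/
theorem sum_step_eq (x : BufferState V) (μ : Policy V) (t : ℕ) :
    ∑ d : Fin V, s (d + 1) * (bufferMiss x d + bufferValue s r w (bufferStep μ t x d)) =
    ∑ z : Fin V, ∑ d : Fin V, s (d + 1) * ((if d = z ∧ x.stack z ∉ x.buffer then (1 : ℝ) else 0) +
      itemValue V s r w (Fin.cycleRange d z) (x.stack z ∈ (bufferStep μ t x d).buffer)) := by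
  rw [Finset.sum_comm]
  refine Finset.sum_congr rfl fun d _ => ?_
  rw [bufferMiss_eq_sum, bufferValue_step, ← Finset.sum_add_distrib, Finset.mul_sum]

theorem sum_item_eq (x : BufferState V) (hV : V ≠ 0) :
    ∑ z : Fin V, (w / V + itemValue V s r w z (x.stack z ∈ x.buffer) -
      if x.stack z ∈ x.buffer then r else 0) = w - r * x.buffer.card + bufferValue s r w x := by
  rw [Finset.sum_sub_distrib, Finset.sum_add_distrib, sum_mem_buffer]
  have : (V : ℝ) ≠ 0 := by exact_mod_cast hV
  simp only [Finset.sum_const, Finset.card_univ, Fintype.card_fin, nsmul_eq_mul, bufferValue]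
  field_simp
  ring

theorem itemValue_self {d : Fin V} (μ : Policy V) (t : ℕ) (x : BufferState V) :
    itemValue V s r w (Fin.cycleRange d d) (x.stack d ∈ (bufferStep μ t x d).buffer) = 0 := by
  rw [itemValue_true _ (self_mem_bufferStep μ t x d), cycleRange_val_self]
  simp

/-- The one-step equation of an item out of the buffer. -/
theorem item_step_of_notMem (hs : IsStackDistribution V s) (x : BufferState V) (μ : Policy V)
    (t : ℕ) (z : Fin V) (hz : x.stack z ∉ x.buffer) :
    ∑ d : Fin V, s (d + 1) * ((if d = z ∧ x.stack z ∉ x.buffer then (1 : ℝ) else 0) +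
      itemValue V s r w (Fin.cycleRange d z) (x.stack z ∈ (bufferStep μ t x d).buffer)) =
    w / V + itemValue V s r w z (x.stack z ∈ x.buffer) := by
  have h1 : ∀ d : Fin V,
      s (d + 1) * ((if d = z ∧ x.stack z ∉ x.buffer then (1 : ℝ) else 0) +
        itemValue V s r w (Fin.cycleRange d z) (x.stack z ∈ (bufferStep μ t x d).buffer)) =
      (if d = z then s (d + 1) else 0) + s (d + 1) * (if d = z then 0 else
        (tail s (Fin.cycleRange d z) - (V - (Fin.cycleRange d z : ℕ)) * (w / V)) /
          tail s (Fin.cycleRange d z)) := by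
    intro d
    by_cases hd : d = z
    · subst hd
      rw [itemValue_self]
      simp [hz]
    · rw [itemValue_false _ (by rw [mem_bufferStep_iff μ t x hd]; exact fun h => hz h.1)]
      simp [hd]
  rw [Finset.sum_congr rfl fun d _ => h1 d, Finset.sum_add_distrib,
    sum_mul_div_tail hs (fun y : ℕ => tail s y - (V - y) * (w / V)) z, itemValue_false _ hz]
  simp only [Finset.sum_ite_eq', Finset.mem_univ, if_true]
  -- The numerator for an absent item vanishes at `V`, so the equation holds at the bottom too. Its
  -- increments `w / V - s (z + 1)` are the average cost minus the expected miss.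
  have h2 : (if (z : ℕ) + 1 < V then
      tail s (z + 1) - ((V : ℝ) - ((z + 1 : ℕ) : ℝ)) * (w / V) else 0) =
      tail s (z + 1) - ((V : ℝ) - ((z + 1 : ℕ) : ℝ)) * (w / V) := by
    split_ifs with h
    · rfl
    · rw [show (z : ℕ) + 1 = V by have := z.2; omega, hs.tail_last]
      simp
  rw [h2, tail_succ]
  push_cast
  ring

/-- The numerators increase by `w / V - r`: average cost minus rent. At `V` they need not vanish;
the defect `V * r - w` is the height of `tail s V + r * V` above `w`. -/
theorem sum_item_mem (hs : IsStackDistribution V s) (z : Fin V) :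
    ∑ d : Fin V, s (d + 1) * (if d = z then 0 else
        ((Fin.cycleRange d z : ℕ) : ℝ) * (w / V - r) /
          tail s (Fin.cycleRange d z)) =
      w / V + z * (w / V - r) / tail s z - r + if (z : ℕ) + 1 < V then 0 else (V * r - w) := by
  have hV : (V : ℝ) ≠ 0 := by have := hs.one_le; positivity
  rw [sum_mul_div_tail hs (fun y : ℕ => (y : ℝ) * (w / V - r)) z]
  split_ifs with h
  · push_cast
    ring
  · have : ((z : ℕ) : ℝ) = V - 1 := by
      have h' : (((z : ℕ) + 1 : ℕ) : ℝ) = V := by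
        rw [show (z : ℕ) + 1 = V by have := z.2; omega]
      push_cast at h'
      linarith
    simp only [this]
    field_simp
    ring

/-- The value of an absent item exceeds that of a present one by `(tail s z + r * z - w) / tail s
z`. Hence eviction never lowers the potential, and leaves it unchanged where the line is tight. -/
theorem itemValue_true_le (hs : IsStackDistribution V s) {z : ℕ} (h2 : z < V)
    (h : w ≤ tail s z + r * z) (b : Prop) [Decidable b] :
    z * (w / V - r) / tail s z ≤ itemValue V s r w z b := by
  have hV : (V : ℝ) ≠ 0 := by have := hs.one_le; positivity
  unfold itemValue
  split_ifs
  · exact le_rfl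
  · refine div_le_div_of_nonneg_right ?_ (hs.tail_pos h2).le
    have : (V : ℝ) * (w / V) = w := by field_simp
    linarith

theorem itemValue_eq_of_tight (hs : IsStackDistribution V s) {z : ℕ}
    (h : w = tail s z + r * z) (b : Prop) [Decidable b] :
    itemValue V s r w z b = z * (w / V - r) / tail s z := by
  have hV : (V : ℝ) ≠ 0 := by have := hs.one_le; positivity
  unfold itemValue
  split_ifs
  · rfl
  · congr 1
    have : (V : ℝ) * (w / V) = w := by field_simp
    linarith

/-- The potential `bufferValue` is a subsolution of the Poisson equation for any policy. -/
theorem le_sum_step (hs : IsStackDistribution V s) (hw : IsSupportingLine V s K L r w)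
    (x : BufferState V) (μ : Policy V) (t : ℕ) :
    w - r * x.buffer.card + bufferValue s r w x ≤
      ∑ d : Fin V, s (d + 1) * (bufferMiss x d + bufferValue s r w (bufferStep μ t x d)) := by
  rw [sum_step_eq, ← sum_item_eq x (by have := hs.one_le; omega)]
  refine Finset.sum_le_sum fun z _ => ?_
  by_cases hz : x.stack z ∈ x.buffer
  · rw [if_pos hz, itemValue_true _ hz]
    have h1 := sum_item_mem (r := r) (w := w) hs z
    have h2 : 0 ≤ (if (z : ℕ) + 1 < V then 0 else (V * r - w)) := by
      split_ifs
      · exact le_rfl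
      · have := hw.le V hs.one_le le_rfl
        rw [hs.tail_last] at this
        linarith
    refine le_trans (by linarith) (h1.symm.le.trans (Finset.sum_le_sum fun d _ => ?_))
    refine mul_le_mul_of_nonneg_left ?_ (hs.fin_nonneg d)
    by_cases hd : d = z
    · subst hd
      rw [itemValue_self]
      simp [hz]
    · have := itemValue_true_le hs (Fin.cycleRange d z).2
        (hw.le _ (one_le_cycleRange hd) (Fin.cycleRange d z).2.le)
        (x.stack z ∈ (bufferStep μ t x d).buffer)
      simpa [hd] using this
  · rw [if_neg hz, item_step_of_notMem hs x μ t z hz]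
    linarith

/-- A policy that evicts only where the supporting line is tight solves the Poisson equation. -/
theorem sum_step_eq_of_tight (hs : IsStackDistribution V s)
    (x : BufferState V) (μ : Policy V) (t : ℕ)
    (hev : ∀ d z, d ≠ z → x.stack z ∈ x.buffer → μ t x d = some (x.stack z) →
      w = tail s (Fin.cycleRange d z) + r * (Fin.cycleRange d z : ℕ))
    (hlast : ∀ z : Fin V, (z : ℕ) + 1 = V → x.stack z ∈ x.buffer → w = r * V) :
    ∑ d : Fin V, s (d + 1) * (bufferMiss x d + bufferValue s r w (bufferStep μ t x d)) =
      w - r * x.buffer.card + bufferValue s r w x := by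
  rw [sum_step_eq, ← sum_item_eq x (by have := hs.one_le; omega)]
  refine Finset.sum_congr rfl fun z _ => ?_
  by_cases hz : x.stack z ∈ x.buffer
  · rw [if_pos hz, itemValue_true _ hz]
    have h1 := sum_item_mem (r := r) (w := w) hs z
    have h2 : (if (z : ℕ) + 1 < V then 0 else (V * r - w)) = 0 := by
      split_ifs with h
      · rfl
      · rw [hlast z (by have := z.2; omega) hz]
        ring
    rw [h2, add_zero] at h1
    rw [← h1]
    refine Finset.sum_congr rfl fun d _ => ?_
    by_cases hd : d = z
    · subst hd
      rw [itemValue_self]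
      simp [hz]
    · by_cases he : μ t x d = some (x.stack z)
      · rw [itemValue_eq_of_tight hs (hev d z hd hz he)]
        simp [hd]
      · rw [itemValue_true _ ((mem_bufferStep_iff μ t x hd).2 ⟨hz, he⟩)]
        simp [hd, hz]
  · rw [if_neg hz, item_step_of_notMem hs x μ t z hz]
    ring

end Potential

/-! ### Lower bound for all policies; the `K`-`L` policy attains it -/

section Policies

variable {V : ℕ} {s : ℕ → ℝ} {K L C : ℕ} {r w : ℝ}

theorem card_bufferStep_le {μ : Policy V} (hμ : μ.Admissible C) (t : ℕ) (x : BufferState V)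
    (d : Fin V) (hx : x.buffer.card ≤ C) : (bufferStep μ t x d).buffer.card ≤ C := by
  have h := hμ t x d hx
  unfold AdmissibleControl at h
  simp only [bufferStep]
  split_ifs at h with hc
  · obtain ⟨j, hj, hu⟩ := h
    rw [hu]
    refine (Finset.card_insert_le _ _).trans ?_
    simp only [Option.toFinset_some, Finset.sdiff_singleton_eq_erase]
    rw [Finset.card_erase_add_one hj]
    exact hx
  · rw [h]
    simp only [Option.toFinset_none, Finset.sdiff_empty]
    by_cases hm : x.stack d ∈ x.buffer
    · rwa [Finset.insert_eq_of_mem hm]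
    · have : x.buffer.card ≠ C := fun h' => hc ⟨hm, h'⟩
      rw [Finset.card_insert_of_notMem hm]
      omega

/-- Weak duality: as `r ≥ 0`, the rent refunded for at most `C` places is at most `r * C`. -/
theorem eventually_lt_of_admissible (hs : IsStackDistribution V s)
    (hw : IsSupportingLine V s K L r w) {μ : Policy V} (hμ : μ.Admissible C) {x₀ : BufferState V}
    (hx₀ : x₀.buffer.card ≤ C) {c : ℝ} (hc : c < w - r * C) :
    ∀ᶠ τ : ℕ in Filter.atTop, c < expectedCost s bufferMiss (bufferStep μ) x₀ τ / τ := by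
  refine eventually_lt_expectedCost hs.fin_nonneg hs.sum_fin
    (I := fun x : BufferState V => x.buffer.card ≤ C)
    (fun t x d => card_bufferStep_le hμ t x d) (bufferValue s r w) (fun t x hx => ?_) hx₀ hc
  refine le_trans ?_ (le_sum_step hs hw x μ t)
  have h1 : (x.buffer.card : ℝ) ≤ C := by exact_mod_cast hx
  have := mul_le_mul_of_nonneg_left h1 hw.nonneg
  linarith

theorem klPolicy_eq_none {t : ℕ} {x : BufferState V} {d : Fin V}
    (h : ¬ (x.stack d ∉ x.buffer ∧ x.buffer.card = C)) : klPolicy C K L t x d = none := by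
  simp only [klPolicy, if_neg h]

theorem klPolicy_admissible (hC : 1 ≤ C) : (klPolicy C K L : Policy V).Admissible C := by
  intro t x d _
  unfold AdmissibleControl
  split_ifs with h
  · simp only [klPolicy, if_pos h]
    obtain ⟨j, hj⟩ : x.buffer.Nonempty := by
      rw [← Finset.card_pos, h.2]; omega
    cases hf : List.find? (fun j => decide (j ∈ x.buffer))
        ((List.ofFn (rotate x.stack d))[L]?.toList ++ (List.ofFn (rotate x.stack d))[K]?.toList ++
          (List.ofFn (rotate x.stack d)).reverse) with
    | none =>
      rw [List.find?_eq_none] at hf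
      -- The search list ends with the whole stack, so it meets any nonempty buffer.
      have hmem : j ∈ (List.ofFn (rotate x.stack d)).reverse := by
        rw [List.mem_reverse, List.mem_ofFn]
        exact ⟨(rotate x.stack d).symm j, by simp⟩
      exact absurd (decide_eq_true hj) (hf j (List.mem_append_right _ hmem))
    | some i =>
      exact ⟨i, by simpa using List.find?_some hf, rfl⟩
  · exact klPolicy_eq_none h

/-- The items of the buffer are the topmost ones until it is full; from then on all the `K`
topmost items are in the buffer, and all the items of the buffer are among the `L` topmost. -/
structure KLInvariant (C K L : ℕ) (x : BufferState V) : Prop where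
  card_le : x.buffer.card ≤ C
  filling : x.buffer.card < C → ∀ z : Fin V, x.stack z ∈ x.buffer ↔ (z : ℕ) < x.buffer.card
  top_mem : x.buffer.card = C → ∀ z : Fin V, (z : ℕ) < K → x.stack z ∈ x.buffer
  lt_of_mem : x.buffer.card = C → ∀ z : Fin V, x.stack z ∈ x.buffer → (z : ℕ) < L

/-- On a miss with a full buffer the item at depth `L + 1` is evicted if it is in the buffer, and
otherwise that at depth `K + 1`. -/
theorem klPolicy_eq_some (hK0 : K = 0 → L = 1) (hKC : K < C) (hCL : C ≤ L) {t : ℕ}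
    {x : BufferState V} (hx : KLInvariant C K L x) {d : Fin V}
    (h : x.stack d ∉ x.buffer ∧ x.buffer.card = C) :
    ∃ z : Fin V, d ≠ z ∧ x.stack z ∈ x.buffer ∧ klPolicy C K L t x d = some (x.stack z) ∧
      ((Fin.cycleRange d z : ℕ) = L ∨
        1 ≤ K ∧ (Fin.cycleRange d z : ℕ) = K ∧
          ∀ y : Fin V, x.stack y ∈ x.buffer → (Fin.cycleRange d y : ℕ) ≠ L) := by
  have hrot : ∀ y : Fin V, rotate x.stack d (Fin.cycleRange d y) = x.stack y := by
    intro y; simp [rotate]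
  have hget : ∀ (m : ℕ) (y : Fin V), (Fin.cycleRange d y : ℕ) = m →
      (List.ofFn (rotate x.stack d))[m]? = some (x.stack y) := by
    rintro m y rfl
    simp [hrot]
  have hdne : ∀ y : Fin V, x.stack y ∈ x.buffer → d ≠ y := by
    rintro y hy rfl
    exact h.1 hy
  by_cases hL : ∃ y : Fin V, x.stack y ∈ x.buffer ∧ (Fin.cycleRange d y : ℕ) = L
  · obtain ⟨y, hy, hyL⟩ := hL
    refine ⟨y, hdne y hy, hy, ?_, Or.inl hyL⟩
    simp [klPolicy, if_pos h, hget L y hyL, hy]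
  · push Not at hL
    -- If `K = 0` then `L = 1`, the buffer holds just the top item, and a miss pushes it to position
    -- `L`, which was excluded.
    have hK : 1 ≤ K := by
      by_contra hK
      have hL1 := hK0 (by omega)
      obtain ⟨j, hj⟩ : x.buffer.Nonempty := by
        rw [← Finset.card_pos, h.2]; omega
      have hj' : x.stack (x.stack.symm j) ∈ x.buffer := by simpa using hj
      have h1 := hx.lt_of_mem h.2 _ hj'
      refine hL _ hj' ?_
      have h2 : x.stack.symm j < d := by
        refine lt_of_le_of_ne ?_ (hdne _ hj').symm
        show ((x.stack.symm j : Fin V) : ℕ) ≤ d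
        omega
      rw [cycleRange_val_of_lt h2]
      omega
    -- The `K` topmost items are present, so a miss lies below them and pushes the one at position
    -- `K - 1` to `K`.
    have hd : K ≤ (d : ℕ) := by
      by_contra hd
      exact h.1 (hx.top_mem h.2 d (by omega))
    have hy : ((⟨K - 1, by omega⟩ : Fin V) : ℕ) < K := by simp; omega
    set y : Fin V := ⟨K - 1, by omega⟩ with hydef
    have hyB := hx.top_mem h.2 y hy
    have hyd : y < d := by
      show (y : ℕ) < d
      omega
    have hyK : (Fin.cycleRange d y : ℕ) = K := by
      rw [cycleRange_val_of_lt hyd, hydef]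
      simp; omega
    refine ⟨y, hdne y hyB, hyB, ?_, Or.inr ⟨hK, hyK, hL⟩⟩
    have hfL : List.find? (fun j => decide (j ∈ x.buffer))
        (List.ofFn (rotate x.stack d))[L]?.toList = none := by
      rw [List.find?_eq_none]
      intro j hj hjB
      rw [Option.mem_toList, List.getElem?_eq_some_iff] at hj
      obtain ⟨hlt, hj⟩ := hj
      simp only [List.length_ofFn] at hlt
      rw [List.getElem_ofFn] at hj
      have e := hrot ((Fin.cycleRange d).symm ⟨L, hlt⟩)
      rw [Equiv.apply_symm_apply, hj] at e
      refine hL ((Fin.cycleRange d).symm ⟨L, hlt⟩) ?_ (by rw [Equiv.apply_symm_apply])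
      rw [← e]
      simpa using hjB
    simp only [klPolicy, if_pos h, hget K y hyK, List.find?_append, hfL]
    simp [hyB]

/-- A filling buffer is a prefix of the stack, and becomes full with `K < C ≤ L`. Afterwards,
evictions at positions `K` or `L` spare the top `K`; a hit is above `L` and pushes nothing to
position `L`, while on a miss the item pushed there is the one evicted. -/
theorem klInvariant_step (hK0 : K = 0 → L = 1) (hKC : K < C) (hCL : C ≤ L) (t : ℕ)
    (x : BufferState V) (d : Fin V) (hx : KLInvariant C K L x) :
    KLInvariant C K L (bufferStep (klPolicy C K L) t x d) := by
  have hcard := card_bufferStep_le (klPolicy_admissible (K := K) (L := L) (by omega)) t x d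
    hx.card_le
  have hle : ∀ z : Fin V, d ≠ z → (z : ℕ) ≤ (Fin.cycleRange d z : ℕ) := by
    intro z hz
    rcases lt_or_gt_of_ne hz with h | h
    · rw [cycleRange_val_of_gt h]
    · rw [cycleRange_val_of_lt h]; omega
  -- membership is tracked along the old positions
  suffices h : (bufferStep (klPolicy C K L) t x d).buffer.card ≤ C ∧
      ((bufferStep (klPolicy C K L) t x d).buffer.card < C → ∀ z : Fin V,
        x.stack z ∈ (bufferStep (klPolicy C K L) t x d).buffer ↔
          (Fin.cycleRange d z : ℕ) < (bufferStep (klPolicy C K L) t x d).buffer.card) ∧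
      ((bufferStep (klPolicy C K L) t x d).buffer.card = C → ∀ z : Fin V,
        (Fin.cycleRange d z : ℕ) < K → x.stack z ∈ (bufferStep (klPolicy C K L) t x d).buffer) ∧
      ((bufferStep (klPolicy C K L) t x d).buffer.card = C → ∀ z : Fin V,
        x.stack z ∈ (bufferStep (klPolicy C K L) t x d).buffer →
          (Fin.cycleRange d z : ℕ) < L) by
    have hst : ∀ z, (bufferStep (klPolicy C K L) t x d).stack z =
        x.stack ((Fin.cycleRange d).symm z) := fun z => rfl
    obtain ⟨h1, h2, h3, h4⟩ := h
    refine ⟨h1, fun hc z => ?_, fun hc z hz => ?_, fun hc z hz => ?_⟩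
    · rw [hst, h2 hc, Equiv.apply_symm_apply]
    · rw [hst]
      exact h3 hc _ (by rwa [Equiv.apply_symm_apply])
    · rw [hst] at hz
      simpa using h4 hc _ hz
  have hself := self_mem_bufferStep (klPolicy C K L) t x d
  have hmem := fun z (hz : d ≠ z) => mem_bufferStep_iff (klPolicy C K L) t x hz
  rcases hx.card_le.lt_or_eq with hlt | hfull
  · -- the buffer is not yet full
    have hn : klPolicy C K L t x d = none := klPolicy_eq_none fun h => hlt.ne h.2
    have hbuf : (bufferStep (klPolicy C K L) t x d).buffer = insert (x.stack d) x.buffer := by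
      simp [bufferStep, hn]
    have hfil := hx.filling hlt
    have htop : ∀ z : Fin V, x.stack z ∈ (bufferStep (klPolicy C K L) t x d).buffer ↔
          (Fin.cycleRange d z : ℕ) < (bufferStep (klPolicy C K L) t x d).buffer.card := by
      intro z
      by_cases hdz : d = z
      · subst hdz
        refine iff_of_true hself ?_
        rw [cycleRange_val_self]
        exact Finset.card_pos.2 ⟨_, hself⟩
      · rw [hmem z hdz, hn, hfil z, hbuf]
        have hdz' : (d : ℕ) ≠ z := fun h => hdz (Fin.ext h)
        by_cases hd : x.stack d ∈ x.buffer
        · rw [Finset.insert_eq_of_mem hd]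
          have hd' := (hfil d).1 hd
          rcases lt_or_gt_of_ne hdz with h | h
          · rw [cycleRange_val_of_gt h]; simp
          · have : (z : ℕ) < d := h
            rw [cycleRange_val_of_lt h]; simp; omega
        · rw [Finset.card_insert_of_notMem hd]
          have hd' := mt (hfil d).2 hd
          rcases lt_or_gt_of_ne hdz with h | h
          · have : (d : ℕ) < z := h
            rw [cycleRange_val_of_gt h]; simp; omega
          · rw [cycleRange_val_of_lt h]; simp
    refine ⟨hcard, fun _ => htop, fun hc z hz => (htop z).2 (by omega), fun hc z hz => ?_⟩
    have := (htop z).1 hz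
    omega
  · by_cases hd : x.stack d ∈ x.buffer
    · -- a hit
      have hn : klPolicy C K L t x d = none := klPolicy_eq_none fun h => h.1 hd
      have hbuf : (bufferStep (klPolicy C K L) t x d).buffer = x.buffer := by
        simp [bufferStep, hn, hd]
      rw [hbuf]
      refine ⟨hfull.le, fun h => absurd hfull h.ne, fun _ z hz => ?_, fun _ z hz => ?_⟩
      · by_cases hdz : d = z
        · rwa [← hdz]
        · exact hx.top_mem hfull z ((hle z hdz).trans_lt hz)
      · have h1 := hx.lt_of_mem hfull z hz
        have h2 := hx.lt_of_mem hfull d hd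
        rcases lt_trichotomy d z with h | h | h
        · rwa [cycleRange_val_of_gt h]
        · rw [h, cycleRange_val_self]; omega
        · have : (z : ℕ) < d := h
          rw [cycleRange_val_of_lt h]; omega
    · -- a miss with a full buffer
      obtain ⟨y, hdy, hyB, hev, hy⟩ := klPolicy_eq_some hK0 hKC hCL (t := t) hx ⟨hd, hfull⟩
      have hcC : (bufferStep (klPolicy C K L) t x d).buffer.card = C := by
        simp only [bufferStep, hev, Option.toFinset_some, Finset.sdiff_singleton_eq_erase]
        rw [Finset.card_insert_of_notMem fun h => hd (Finset.mem_of_mem_erase h),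
          Finset.card_erase_add_one hyB, hfull]
      refine ⟨hcard, fun h => absurd hcC h.ne, fun _ z hz => ?_, fun _ z hz => ?_⟩
      · by_cases hdz : d = z
        · rwa [← hdz]
        · refine (hmem z hdz).2 ⟨hx.top_mem hfull z ((hle z hdz).trans_lt hz), fun h => ?_⟩
          rw [hev] at h
          have : y = z := x.stack.injective (Option.some.inj h)
          subst this
          rcases hy with hy | ⟨_, hy, _⟩ <;> omega
      · by_cases hdz : d = z
        · rw [hdz, cycleRange_val_self]; omega
        · obtain ⟨hzB, hne⟩ := (hmem z hdz).1 hz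
          have h1 := hx.lt_of_mem hfull z hzB
          have h2 : (Fin.cycleRange d z : ℕ) ≤ z + 1 := by
            rcases lt_or_gt_of_ne hdz with h | h
            · rw [cycleRange_val_of_gt h]; omega
            · rw [cycleRange_val_of_lt h]
          have h3 : (Fin.cycleRange d z : ℕ) ≠ L := by
            intro hzL
            rcases hy with hy | ⟨_, _, hy⟩
            · have : y = z := (Fin.cycleRange d).injective (Fin.ext (hy.trans hzL.symm))
              exact hne (by rw [hev, this])
            · exact hy z hzB hzL
          omega

theorem klPolicy_sum_step (hs : IsStackDistribution V s) (hw : IsSupportingLine V s K L r w)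
    (hK0 : K = 0 → L = 1) (hKC : K < C) (hCL : C ≤ L) (hL : L ≤ V) (t : ℕ)
    (x : BufferState V) (hx : KLInvariant C K L x) :
    ∑ d : Fin V, s (d + 1) *
      (bufferMiss x d + bufferValue s r w (bufferStep (klPolicy C K L) t x d)) =
      w - r * x.buffer.card + bufferValue s r w x := by
  refine sum_step_eq_of_tight hs x _ t (fun d z hdz hz he => ?_) (fun z hzV hz => ?_)
  · by_cases h : x.stack d ∉ x.buffer ∧ x.buffer.card = C
    · obtain ⟨y, hdy, hyB, hev, hy⟩ := klPolicy_eq_some hK0 hKC hCL (t := t) hx h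
      rw [hev] at he
      have : y = z := x.stack.injective (Option.some.inj he)
      subst this
      rcases hy with hy | ⟨h1, hy, _⟩
      · rw [hy, hw.right]
      · rw [hy, hw.left h1]
    · rw [klPolicy_eq_none h] at he
      exact absurd he (by simp)
  · have h1 : (z : ℕ) < L := by
      rcases hx.card_le.lt_or_eq with hlt | hfull
      · have := (hx.filling hlt z).1 hz
        omega
      · exact hx.lt_of_mem hfull z hz
    obtain rfl : L = V := by omega
    rw [← hw.right, hs.tail_last, zero_add]

/-- In expectation the number of free places decreases by `s V` at least, as long as it is
positive. -/
theorem klPolicy_sum_free (hs : IsStackDistribution V s) (hK0 : K = 0 → L = 1) (hKC : K < C)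
    (hCL : C ≤ L) (hL : L ≤ V) (t : ℕ) (x : BufferState V) (hx : KLInvariant C K L x) :
    ∑ d : Fin V, s (d + 1) *
      ((C : ℝ) - (bufferStep (klPolicy C K L) t x d).buffer.card) ≤
      (C - x.buffer.card) - (if x.buffer.card < C then s V else 0) := by
  have hcard : ∀ d, x.buffer.card ≤ (bufferStep (klPolicy C K L) t x d).buffer.card := by
    intro d
    by_cases h : x.stack d ∉ x.buffer ∧ x.buffer.card = C
    · obtain ⟨y, hdy, hyB, hev, hy⟩ := klPolicy_eq_some hK0 hKC hCL (t := t) hx h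
      simp only [bufferStep, hev, Option.toFinset_some, Finset.sdiff_singleton_eq_erase]
      rw [Finset.card_insert_of_notMem fun h' => h.1 (Finset.mem_of_mem_erase h'),
          Finset.card_erase_add_one hyB]
    · simp only [bufferStep, klPolicy_eq_none h, Option.toFinset_none, Finset.sdiff_empty]
      exact Finset.card_le_card (Finset.subset_insert _ _)
  have hV := hs.one_le
  -- As long as the buffer is a proper prefix, an access to the bottom of the stack is a miss that
  -- takes a free place.
  set v : Fin V := ⟨V - 1, by omega⟩ with hv
  have hv1 : (v : ℕ) + 1 = V := by simp [hv]; omega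
  have h1 : ∀ d : Fin V, s (d + 1) * ((C : ℝ) - (bufferStep (klPolicy C K L) t x d).buffer.card) ≤
      s (d + 1) * (C - x.buffer.card) -
        (if d = v then (if x.buffer.card < C then s V else 0) else 0) := by
    intro d
    have h2 : (x.buffer.card : ℝ) ≤ (bufferStep (klPolicy C K L) t x d).buffer.card := by
      exact_mod_cast hcard d
    have h3 := hs.fin_nonneg d
    by_cases hdv : d = v
    · subst hdv
      rw [if_pos rfl]
      split_ifs with hlt
      · have hm : x.stack v ∉ x.buffer := by
          rw [hx.filling hlt v]
          omega
        have h4 : (bufferStep (klPolicy C K L) t x v).buffer.card = x.buffer.card + 1 := by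
          have hn : klPolicy C K L t x v = none := klPolicy_eq_none fun h => hlt.ne h.2
          simp only [bufferStep, hn, Option.toFinset_none, Finset.sdiff_empty]
          rw [Finset.card_insert_of_notMem hm]
        rw [h4, hv1]
        push_cast
        linarith
      · rw [sub_zero]
        exact mul_le_mul_of_nonneg_left (by linarith) h3
    · rw [if_neg hdv, sub_zero]
      exact mul_le_mul_of_nonneg_left (by linarith) h3
  refine (Finset.sum_le_sum fun d _ => h1 d).trans ?_
  rw [Finset.sum_sub_distrib, ← Finset.sum_mul, hs.sum_fin]
  simp

/-- The potential solves the Poisson equation exactly when the buffer is full. While it fills, the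
right-hand side is too large by `r * (C - card)`. The added multiple of the number of free places
absorbs this excess: its expected decrease is at least `r * C / s V * s V = r * C`. -/
theorem klPolicy_isGainOptimal (hs : IsStackDistribution V s) (hw : IsSupportingLine V s K L r w)
    (hK0 : K = 0 → L = 1) (hKC : K < C) (hCL : C ≤ L) (hL : L ≤ V) :
    IsGainOptimal (V := V) s C (klPolicy C K L) (w - r * C) := by
  refine ⟨klPolicy_admissible (by omega), fun Λ => ?_, fun μ hμ x₀ hx₀ c hc =>
    eventually_lt_of_admissible hs hw hμ hx₀ hc⟩
  have hcard : ∀ x : BufferState V, KLInvariant C K L x → (x.buffer.card : ℝ) ≤ C :=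
    fun x hx => by exact_mod_cast hx.card_le
  have hsV := hs.last_pos
  refine hasAverageCost_of_le_of_ge hs.fin_nonneg hs.sum_fin (I := KLInvariant C K L)
    (klInvariant_step hK0 hKC hCL) (bufferValue s r w)
    (fun x => bufferValue s r w x + r * C / s V * (C - x.buffer.card))
    (fun t x hx => ?_) (fun t x hx => ?_) ⟨by simp, by simp, ?_, by simp⟩
  · rw [klPolicy_sum_step hs hw hK0 hKC hCL hL t x hx]
    have := mul_le_mul_of_nonneg_left (hcard x hx) hw.nonneg
    linarith
  · have h1 := klPolicy_sum_step hs hw hK0 hKC hCL hL t x hx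
    have h2 := klPolicy_sum_free hs hK0 hKC hCL hL t x hx
    have h3 : 0 ≤ r * C / s V := div_nonneg (mul_nonneg hw.nonneg C.cast_nonneg) hsV.le
    have h4 : ∑ d : Fin V, s (d + 1) * (bufferMiss x d +
        (bufferValue s r w (bufferStep (klPolicy C K L) t x d) + r * C / s V *
          (C - (bufferStep (klPolicy C K L) t x d).buffer.card))) =
        ∑ d : Fin V, s (d + 1) *
          (bufferMiss x d + bufferValue s r w (bufferStep (klPolicy C K L) t x d)) +
        r * C / s V * ∑ d : Fin V, s (d + 1) *
          ((C : ℝ) - (bufferStep (klPolicy C K L) t x d).buffer.card) := by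
      rw [Finset.mul_sum, ← Finset.sum_add_distrib]
      exact Finset.sum_congr rfl fun d _ => by ring
    rw [h4, h1]
    have h5 := mul_le_mul_of_nonneg_left h2 h3
    split_ifs at h5 with hlt
    · have h6 : r * C / s V * s V = r * C := by field_simp
      have h7 : 0 ≤ r * x.buffer.card := mul_nonneg hw.nonneg (Nat.cast_nonneg _)
      rw [mul_sub, h6] at h5
      linarith
    · have : x.buffer.card = C := le_antisymm hx.card_le (by omega)
      rw [this] at h5 ⊢
      linarith
  · intro h
    simp at h
    omega

end Policies

end LRUSM

namespace LRUSM

/-! ### Correctness and running time of the scan -/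

section Commands

theorem Exec.of_eq {c : Cmd} {σ σ' : Store} {T T' : ℕ} (h : Exec c σ σ' T) (hT : T = T') :
    Exec c σ σ' T' := hT ▸ h

/-- The body of `scanMerge`. -/
theorem exec_mergeBody (σ : Store) : ∃ σ₁,
    Exec (.seq (.setNu (.reg .j) (.nu (.reg .n)))
      (.seq (.setArr .pi (.reg .j) (.add (.arr .pi (.reg .j)) (.arr .pi (.reg .n))))
      (.seq (.setArr .delta (.reg .j) (.add (.arr .delta (.reg .j)) (.arr .delta (.reg .n))))
        setNext))) σ σ₁ 23 ∧
    σ₁.reg .V = σ.reg .V ∧ σ₁.reg .j = σ.reg .j ∧ σ₁.reg .n = σ.nu (σ.reg .n) + 1 ∧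
    σ₁.nu = Function.update σ.nu (σ.reg .j) (σ.nu (σ.reg .n)) ∧
    σ₁.arr .s = σ.arr .s ∧
    σ₁.arr .pi = Function.update (σ.arr .pi) (σ.reg .j)
      (σ.arr .pi (σ.reg .j) + σ.arr .pi (σ.reg .n)) ∧
    σ₁.arr .delta = Function.update (σ.arr .delta) (σ.reg .j)
      (σ.arr .delta (σ.reg .j) + σ.arr .delta (σ.reg .n)) ∧
    σ₁.out = σ.out := by
  refine ⟨_, Exec.of_eq (.seq (.setNu _ _ _) (.seq (.setArr _ _ _ _) (.seq (.setArr _ _ _ _)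
    (.setReg _ _ _)))) rfl, ?_⟩
  simp [NatExpr.eval, RealExpr.eval]

/-- The part of the body of `scanMain` that precedes `scanMerge`. -/
theorem exec_openBlock (σ : Store) :
    ∃ σ₁, (∀ c σ' T, Exec c σ₁ σ' T → Exec (.seq (.setNu (.reg .j) (.reg .j))
      (.seq (.setArr .pi (.reg .j) (.arr .s (.reg .j)))
      (.seq (.setArr .delta (.reg .j) (.lit 1)) (.seq setNext c)))) σ σ' (T + 15)) ∧
    σ₁.reg .V = σ.reg .V ∧ σ₁.reg .j = σ.reg .j ∧ σ₁.reg .n = σ.reg .j + 1 ∧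
    σ₁.nu = Function.update σ.nu (σ.reg .j) (σ.reg .j) ∧
    σ₁.arr .s = σ.arr .s ∧
    σ₁.arr .pi = Function.update (σ.arr .pi) (σ.reg .j) (σ.arr .s (σ.reg .j)) ∧
    σ₁.arr .delta = Function.update (σ.arr .delta) (σ.reg .j) 1 ∧
    σ₁.out = σ.out := by
  refine ⟨_, fun c σ' T h => Exec.of_eq (.seq (.setNu _ _ _) (.seq (.setArr _ _ _ _)
    (.seq (.setArr _ _ _ _) (.seq (.setReg _ _ _) h)))) ?_, ?_⟩
  · simp only [NatExpr.cost, RealExpr.cost]; omega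
  · simp [NatExpr.eval, RealExpr.eval]

end Commands

/-- Cell `m + 1` holds the block `m + 1, …, e`. -/
structure IsBlock (s : ℕ → ℝ) (σ : Store) (m e : ℕ) : Prop where
  nu : σ.nu (m + 1) = e
  pi : σ.arr .pi (m + 1) = cum s e - cum s m
  delta : σ.arr .delta (m + 1) = (e : ℝ) - m

/-- The cells `m + 1, …, V` have been processed. -/
structure ScanInvariant (V : ℕ) (s : ℕ → ℝ) (m : ℕ) (σ : Store) : Prop where
  reg_V : σ.reg .V = V
  arr_s : ∀ j, 1 ≤ j → j ≤ V → σ.arr .s j = s j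
  out_nil : σ.out = []
  nu_one : σ.nu 1 = 1
  pi_last : σ.arr .pi (V + 1) = 0
  delta_last : σ.arr .delta (V + 1) = 1
  block : ∀ i, m ≤ i → i < V → ∃ e, IsNext V s i e ∧ IsBlock s σ i e

section Scan

variable {V : ℕ} {s : ℕ → ℝ}

/-- The invariant reads only the cells `1`, `V + 1` and those beyond `m`, so a write at another cell
`p` is harmless. When only a register changes, `p = 0` serves. -/
theorem ScanInvariant.frame {m p : ℕ} {σ σ' : Store} (h : ScanInvariant V s m σ) (hpm : p ≤ m)
    (hp1 : p ≠ 1) (hpV : p ≠ V + 1) (hV : σ'.reg .V = σ.reg .V) (hs : σ'.arr .s = σ.arr .s)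
    (hout : σ'.out = σ.out) (hnu : ∀ i, i ≠ p → σ'.nu i = σ.nu i)
    (hpi : ∀ i, i ≠ p → σ'.arr .pi i = σ.arr .pi i)
    (hdelta : ∀ i, i ≠ p → σ'.arr .delta i = σ.arr .delta i) : ScanInvariant V s m σ' where
  reg_V := by rw [hV, h.reg_V]
  arr_s := by rw [hs]; exact h.arr_s
  out_nil := by rw [hout, h.out_nil]
  nu_one := by rw [hnu 1 hp1.symm, h.nu_one]
  pi_last := by rw [hpi _ hpV.symm, h.pi_last]
  delta_last := by rw [hdelta _ hpV.symm, h.delta_last]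
  block i h1 h2 := by
    obtain ⟨e, he, hb⟩ := h.block i h1 h2
    have hne : i + 1 ≠ p := by omega
    exact ⟨e, he, by rw [hnu _ hne, hb.nu], by rw [hpi _ hne, hb.pi],
      by rw [hdelta _ hne, hb.delta]⟩

theorem ScanInvariant.extend {m e : ℕ} {σ : Store} (h : ScanInvariant V s (m + 1) σ)
    (he : IsNext V s m e) (hb : IsBlock s σ m e) : ScanInvariant V s m σ where
  reg_V := h.reg_V
  arr_s := h.arr_s
  out_nil := h.out_nil
  nu_one := h.nu_one
  pi_last := h.pi_last
  delta_last := h.delta_last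
  block i h1 h2 := by
    rcases h1.eq_or_lt with rfl | h1
    · exact ⟨e, he, hb⟩
    · exact h.block i h1 h2

/-- Here `l` lists the ends of the blocks to the right. Each merge costs `35` and removes one of
them; the failing test costs `12`. The equation for `T` is this amortized count. -/
theorem exec_scanMerge (hs : IsStackDistribution V s) {e : ℕ} {l : List ℕ}
    (hl : HullChain V s e l) {m : ℕ} (hm : 1 ≤ m) (he : IsPrefixMax V s m e) {σ : Store}
    (hσ : ScanInvariant V s (m + 1) σ) (hj : σ.reg .j = m + 1) (hn : σ.reg .n = e + 1)
    (hb : IsBlock s σ m e) :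
    ∃ σ' T e' l', Exec scanMerge σ σ' T ∧ ScanInvariant V s m σ' ∧ σ'.reg .j = m + 1 ∧
      IsNext V s m e' ∧ HullChain V s e' l' ∧ T + 35 * l'.length = 35 * l.length + 12 := by
  induction hl generalizing σ with
  | last =>
    refine ⟨σ, 12, V, [], .loopExit ?_, hσ.extend he.isNext_last hb, hj, he.isNext_last, .last,
      by simp⟩
    simp only [Test.holds, ratio, RealExpr.eval, NatExpr.eval, hj, hn, hb.pi, hb.delta,
      hσ.pi_last, hσ.delta_last, not_le, zero_div]
    exact slope_last_pos hs he.lt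
  | @cons e f l hf hl ih =>
    obtain ⟨f', hf', hbf⟩ := hσ.block e he.lt (hf.lt.trans_le hf.le)
    obtain rfl := hf.unique hf'
    have htest : (Test.realLe (ratio (.reg .j)) (ratio (.reg .n))).holds σ ↔
        slope s m e ≤ slope s e f := by
      simp only [Test.holds, ratio, RealExpr.eval, NatExpr.eval, hj, hn, hb.pi, hb.delta,
        hbf.pi, hbf.delta, slope]
    by_cases hle : slope s m e ≤ slope s e f
    · obtain ⟨σ₁, hex, h1, h2, h3, h4, h5, h6, h7, h8⟩ := exec_mergeBody σ
      rw [hj] at h4 h6 h7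
      rw [hn, hbf.nu] at h3 h4
      rw [hn, hb.pi, hbf.pi] at h6
      rw [hn, hb.delta, hbf.delta] at h7
      have hσ₁ : ScanInvariant V s (m + 1) σ₁ := by
        have := hf.le
        have := hf.lt
        have := he.lt
        refine hσ.frame (p := m + 1) le_rfl (by omega) (by omega) h1 h5 h8 ?_ ?_ ?_
        · intro i hi; rw [h4, Function.update_of_ne hi]
        · intro i hi; rw [h6, Function.update_of_ne hi]
        · intro i hi; rw [h7, Function.update_of_ne hi]
      have hb₁ : IsBlock s σ₁ m f :=
        ⟨by rw [h4, Function.update_self], by rw [h6, Function.update_self]; ring,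
          by rw [h7, Function.update_self]; ring⟩
      obtain ⟨σ', T, e', l', hex', i1, i2, i3, i4, i5⟩ :=
        ih (he.merge hf hle) hσ₁ (h2.trans hj) h3 hb₁
      refine ⟨σ', _, e', l', .loopStep (htest.2 hle) hex hex', i1, i2, i3, i4, ?_⟩
      simp only [Test.cost, ratio, RealExpr.cost, NatExpr.cost, List.length_cons]
      omega
    · have hnext := he.isNext_of_lt hf (not_le.1 hle)
      exact ⟨σ, 12, e, f :: l, .loopExit (mt htest.1 hle), hσ.extend hnext hb, hj, hnext,
        .cons hf hl, by omega⟩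

/-- The loop of `scanMain`. -/
theorem exec_scanMain_loop (hs : IsStackDistribution V s) {m : ℕ} (hmV : m + 1 ≤ V)
    {l : List ℕ} (hl : HullChain V s (m + 1) l) {σ : Store}
    (hσ : ScanInvariant V s (m + 1) σ) (hj : σ.reg .j = m + 1) :
    ∃ σ' T l', Exec (.loop (.natLe (.lit 2) (.reg .j)) (
        .seq (.setNu (.reg .j) (.reg .j))
        (.seq (.setArr .pi (.reg .j) (.arr .s (.reg .j)))
        (.seq (.setArr .delta (.reg .j) (.lit 1))
        (.seq setNext (.seq scanMerge (.setReg .j (.sub (.reg .j) (.lit 1))))))))) σ σ' T ∧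
      ScanInvariant V s 1 σ' ∧ HullChain V s 1 l' ∧
      T + 35 * l'.length = 35 * l.length + 70 * m + 4 := by
  induction m generalizing l σ with
  | zero =>
    refine ⟨σ, 4, l, .loopExit ?_, hσ, hl, by omega⟩
    simp [Test.holds, NatExpr.eval, hj]
  | succ m ih =>
    obtain ⟨σ₁, hopen, h1, h2, h3, h4, h5, h6, h7, h8⟩ := exec_openBlock σ
    rw [hj] at h2 h3 h4 h6 h7
    rw [hσ.arr_s (m + 1 + 1) (by omega) hmV] at h6
    have hσ₁ : ScanInvariant V s (m + 1 + 1) σ₁ := by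
      refine hσ.frame (p := m + 1 + 1) le_rfl (by omega) (by omega) h1 h5 h8 ?_ ?_ ?_
      · intro i hi; rw [h4, Function.update_of_ne hi]
      · intro i hi; rw [h6, Function.update_of_ne hi]
      · intro i hi; rw [h7, Function.update_of_ne hi]
    have hb₁ : IsBlock s σ₁ (m + 1) (m + 1 + 1) :=
      ⟨by rw [h4, Function.update_self], by rw [h6, Function.update_self, cum_succ s (m + 1)]; ring,
        by rw [h7, Function.update_self]; push_cast; ring⟩
    obtain ⟨σ₂, T₂, e, l₂, hex₂, hσ₂, hj₂, he, hl₂, hT₂⟩ :=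
      exec_scanMerge hs hl (by omega) (isPrefixMax_succ hmV) hσ₁ h2 h3 hb₁
    have hdec := Exec.setReg .j (.sub (.reg .j) (.lit 1)) σ₂
    have hσ₃ := hσ₂.frame (p := 0) (by omega) (by omega) (by omega) (σ' :=
      { σ₂ with reg := Function.update σ₂.reg .j ((NatExpr.sub (.reg .j) (.lit 1)).eval σ₂) })
      (by simp) rfl rfl (fun _ _ => rfl) (fun _ _ => rfl) (fun _ _ => rfl)
    obtain ⟨σ', T, l', hex, hσ', hl', hT⟩ :=
      ih (by omega) (.cons he hl₂) hσ₃ (by simp [NatExpr.eval, hj₂])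
    refine ⟨σ', _, l', .loopStep ?_ (hopen _ _ _ (.seq hex₂ hdec)) hex, hσ', hl', ?_⟩
    · simp [Test.holds, NatExpr.eval, hj]
    -- A turn costs `35` apart from merges (`4` test, `15` opening, `12` failing test, `4`
    -- decrement), and `35` more is saved up for the later removal of the new block: `70` in all.
    · simp only [Test.cost, NatExpr.cost, List.length_cons] at hT ⊢
      omega

theorem exec_scanInit {σ : Store} (hσ : IsInput V s σ) :
    ∃ σ', Exec scanInit σ σ' 20 ∧ ScanInvariant V s V σ' := by
  refine ⟨_, Exec.of_eq (.seq (.setNu _ _ _) (.seq (.setArr _ _ _ _) (.seq (.setArr _ _ _ _)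
    (.seq (.setArr _ _ _ _) (.setArr _ _ _ _))))) rfl, ?_⟩
  constructor
  · exact hσ.reg_V
  · intro j h1 h2
    simpa using hσ.arr_s j h1 h2
  · exact hσ.out_nil
  · simp [NatExpr.eval]
  · simp [NatExpr.eval, RealExpr.eval, hσ.reg_V]
  · simp [NatExpr.eval, RealExpr.eval, hσ.reg_V]
  · intro i h1 h2
    omega

theorem exec_scanMain (hs : IsStackDistribution V s) {σ : Store} (hσ : ScanInvariant V s V σ) :
    ∃ σ' T l, Exec scanMain σ σ' T ∧ ScanInvariant V s 1 σ' ∧ HullChain V s 1 l ∧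
      T + 35 * l.length + 64 = 70 * V := by
  obtain ⟨m, rfl⟩ : ∃ m, V = m + 1 := ⟨V - 1, by have := hs.one_le; omega⟩
  have hσ₁ := hσ.frame (p := 0) (by omega) (by omega) (by omega) (σ' :=
      { σ with reg := Function.update σ.reg .j ((NatExpr.reg .V).eval σ) })
      (by simp) rfl rfl (fun _ _ => rfl) (fun _ _ => rfl) (fun _ _ => rfl)
  obtain ⟨σ', T, l, hex, hσ', hl, hT⟩ := exec_scanMain_loop hs le_rfl .last hσ₁
    (by simp [NatExpr.eval, hσ.reg_V])
  refine ⟨σ', _, l, .seq (.setReg _ _ _) hex, hσ', hl, ?_⟩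
  simp only [NatExpr.cost, List.length_nil] at hT ⊢
  omega

/-- The body of the loop of `scanPrintQ`. -/
theorem exec_printQBody (σ : Store) : ∃ σ₁,
    Exec (.seq (.printQ (.reg .i) (.nu (.reg .j)))
      (.seq (.setReg .j (.add (.nu (.reg .j)) (.lit 1)))
        (.setReg .i (.add (.reg .i) (.lit 1))))) σ σ₁ 13 ∧
    σ₁.reg .V = σ.reg .V ∧ σ₁.reg .j = σ.nu (σ.reg .j) + 1 ∧ σ₁.reg .i = σ.reg .i + 1 ∧
    σ₁.nu = σ.nu ∧ σ₁.out = σ.out ++ [.q (σ.reg .i) (σ.nu (σ.reg .j))] := by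
  refine ⟨_, Exec.of_eq (.seq (.printQ _ _ _) (.seq (.setReg _ _ _) (.setReg _ _ _))) rfl, ?_⟩
  simp [NatExpr.eval]

/-- The loop of `scanPrintQ` from a hull vertex on. -/
theorem exec_scanPrintQ_loop {m : ℕ} {l : List ℕ} (hl : HullChain V s m l) {σ : Store}
    (hV : σ.reg .V = V) (hnu : ∀ i, m ≤ i → i < V → IsNext V s i (σ.nu (i + 1)))
    (hj : σ.reg .j = m + 1) :
    ∃ σ', Exec (.loop (.natLe (.reg .j) (.reg .V)) (
      .seq (.printQ (.reg .i) (.nu (.reg .j)))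
      (.seq (.setReg .j (.add (.nu (.reg .j)) (.lit 1)))
        (.setReg .i (.add (.reg .i) (.lit 1)))))) σ σ' (17 * l.length + 4) ∧
      σ'.reg .V = V ∧ printedQ σ'.out = printedQ σ.out ++ l.zipIdx (σ.reg .i) := by
  induction hl generalizing σ with
  | last =>
    refine ⟨σ, .loopExit ?_, hV, by simp⟩
    simp [Test.holds, NatExpr.eval, hj, hV]
  | @cons m e l he hl ih =>
    obtain ⟨σ₁, hex, h1, h2, h3, h4, h5⟩ := exec_printQBody σ
    have hmV := he.lt.trans_le he.le
    have hme : σ.nu (m + 1) = e := (hnu m le_rfl hmV).unique he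
    rw [hj, hme] at h2 h5
    obtain ⟨σ', hex', i1, i2⟩ := ih (h1.trans hV)
      (fun i hi => by rw [h4]; exact hnu i (he.lt.le.trans hi)) h2
    refine ⟨σ', Exec.of_eq (.loopStep ?_ hex hex') ?_, i1, ?_⟩
    · simp only [Test.holds, NatExpr.eval, hj, hV]; omega
    · simp only [Test.cost, NatExpr.cost, List.length_cons]; omega
    · rw [i2, h3, h5]
      simp [printedQ, List.zipIdx_cons]

theorem exec_scanPrintQ (hs : IsStackDistribution V s) {l : List ℕ} (hl : HullChain V s 1 l)
    {σ : Store} (hσ : ScanInvariant V s 1 σ) :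
    ∃ σ', Exec scanPrintQ σ σ' (17 * l.length + 25) ∧ σ'.reg .V = V ∧
      printedQ σ'.out = (1 :: l).zipIdx 1 := by
  have hV := hs.one_le
  -- The first turn is separate: cell `1` is never scanned and keeps the preset `ν[1] = 1`, which
  -- need not be a hull edge from `0`. From `1` on, the loop follows the chain.
  obtain ⟨σ₂, hex, h1, h2, h3, h4, h5⟩ := exec_printQBody
    { σ with reg := Function.update (Function.update σ.reg .j 1) .i 1 }
  simp only [Function.update_self, ne_eq, reduceCtorEq, not_false_eq_true,
    Function.update_of_ne, hσ.nu_one, hσ.out_nil, hσ.reg_V] at h1 h2 h3 h4 h5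
  obtain ⟨σ', hex', i1, i2⟩ := exec_scanPrintQ_loop hl h1 (fun i hi hiV => by
    obtain ⟨e, he, hb⟩ := hσ.block i hi hiV
    rw [h4, hb.nu]
    exact he) h2
  refine ⟨σ', Exec.of_eq (.seq (.setReg _ _ _) (.seq (.setReg _ _ _)
    (.loopStep ?_ hex hex'))) ?_, i1, ?_⟩
  · simp [Test.holds, NatExpr.eval, hσ.reg_V, hV]
  · simp only [Test.cost, NatExpr.cost]; omega
  · rw [i2, h3, h5]
    simp [printedQ, List.zipIdx_cons]

/-- The body of the loop of `scanPrintXi`. -/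
theorem exec_printXiBody (σ : Store) : ∃ σ₁,
    Exec (.seq (.printXi (.reg .j) (ratio (.reg .j))) (.setReg .j (.add (.reg .j) (.lit 1))))
      σ σ₁ 11 ∧
    σ₁.reg .V = σ.reg .V ∧ σ₁.reg .j = σ.reg .j + 1 ∧ printedQ σ₁.out = printedQ σ.out := by
  refine ⟨_, Exec.of_eq (.seq (.printXi _ _ _) (.setReg _ _ _)) rfl, ?_⟩
  simp [NatExpr.eval, printedQ]

theorem exec_scanPrintXi_loop (k : ℕ) {σ : Store} (hj : σ.reg .j + k = σ.reg .V + 1) :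
    ∃ σ', Exec (.loop (.natLe (.reg .j) (.reg .V)) (
      .seq (.printXi (.reg .j) (ratio (.reg .j))) (.setReg .j (.add (.reg .j) (.lit 1)))))
        σ σ' (15 * k + 4) ∧ printedQ σ'.out = printedQ σ.out := by
  induction k generalizing σ with
  | zero =>
    refine ⟨σ, .loopExit ?_, rfl⟩
    simp only [Test.holds, NatExpr.eval]; omega
  | succ k ih =>
    obtain ⟨σ₁, hex, h1, h2, h3⟩ := exec_printXiBody σ
    obtain ⟨σ', hex', h4⟩ := ih (σ := σ₁) (by omega)
    refine ⟨σ', Exec.of_eq (.loopStep ?_ hex hex') ?_, h4.trans h3⟩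
    · simp only [Test.holds, NatExpr.eval]; omega
    · simp only [Test.cost, NatExpr.cost]; omega

theorem exec_scanPrintXi {σ : Store} {k : ℕ} (hV : σ.reg .V = k + 1) :
    ∃ σ', Exec scanPrintXi σ σ' (15 * k + 6) ∧ printedQ σ'.out = printedQ σ.out := by
  obtain ⟨σ', hex, h⟩ := exec_scanPrintXi_loop k
    (σ := { σ with reg := Function.update σ.reg .j 2 }) (by simp [hV]; omega)
  refine ⟨σ', Exec.of_eq (.seq (.setReg _ _ _) hex) ?_, h⟩
  simp only [NatExpr.cost]; omega

theorem HullChain.length_add_le {m : ℕ} {l : List ℕ} (h : HullChain V s m l) :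
    l.length + m ≤ V := by
  induction h with
  | last => simp
  | cons he _ ih =>
    have := he.lt
    rw [List.length_cons]
    omega

theorem exec_grahamScan (hs : IsStackDistribution V s) {l : List ℕ} (hl : HullChain V s 1 l)
    {σ : Store} (hσ : IsInput V s σ) :
    ∃ σ' T, Exec grahamScan σ σ' T ∧ printedQ σ'.out = (1 :: l).zipIdx 1 ∧
      V ≤ T ∧ T ≤ 85 * V := by
  obtain ⟨σ₁, hex₁, h₁⟩ := exec_scanInit hσ
  obtain ⟨σ₂, T₂, l', hex₂, h₂, hl', hT₂⟩ := exec_scanMain hs h₁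
  obtain rfl := hl'.unique hl
  obtain ⟨σ₃, hex₃, hV₃, hout₃⟩ := exec_scanPrintQ hs hl h₂
  have hV := hs.one_le
  obtain ⟨σ₄, hex₄, hout₄⟩ := exec_scanPrintXi (k := V - 1) (hV₃.trans (by omega))
  -- The total is `85 * V - 28 - 18 * l.length`, and `l.length ≤ V - 1` gives the lower bound.
  have hlen := hl.length_add_le
  exact ⟨σ₄, _, .seq hex₁ (.seq hex₂ (.seq hex₃ hex₄)), hout₄.trans hout₃, by omega, by omega⟩

end Scan

end LRUSM

open LRUSM in
/-- There are absolute constants `c₁, c₂ > 0` such that for every `V ≥ 1` and every stack-distance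
distribution `s` on `{1, …, V}` with `s V ≠ 0`, with `q = [q₁, …, q_l]` the increasing list of the
`k ∈ {1, …, V}` for which `ev_k` is a supported efficient policy (so that `q₁ = 1` and `q_l = V`):
the scan prints exactly `q_1, …, q_l`, in time between `c₁ V` and `c₂ V`; and for every capacity
`1 ≤ C ≤ V` exactly one pair of consecutive entries `K`, `L` of `0, q₁, …, q_l` satisfies
`K < C ≤ L`, and for it the `K`-`L` policy is gain optimal for capacity `C`, with a miss rate that
is the optimum of the average occupancy problem. The entry `0` plays a role only for `C = 1`. -/
theorem mainTheorem2 :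
    ∃ c₁ c₂ : ℝ, 0 < c₁ ∧ 0 < c₂ ∧
      ∀ (V : ℕ) [NeZero V] (s : ℕ → ℝ), IsStackDistribution V s →
        ∃ q : List ℕ,
          q.Pairwise (· < ·) ∧
          (∀ k : ℕ, k ∈ q ↔ 1 ≤ k ∧ k ≤ V ∧ IsSupportedEv V s k) ∧
          q.head? = some 1 ∧ q.getLast? = some V ∧
          (∀ σ : Store, IsInput V s σ →
            ∃ (σ' : Store) (T : ℕ), Exec grahamScan σ σ' T ∧
              printedQ σ'.out = q.zipIdx 1 ∧
              c₁ * V ≤ T ∧ T ≤ c₂ * V) ∧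
          ∀ C : ℕ, 1 ≤ C → C ≤ V →
            ∃ K L : ℕ,
              (∀ K' L' : ℕ, ([K', L'] <:+: 0 :: q ∧ K' < C ∧ C ≤ L') ↔ K' = K ∧ L' = L) ∧
              ∃ M : ℝ, IsGainOptimal (V := V) s C (klPolicy C K L) M ∧
                IsAverageOccupancyOptimum V s C M := by
  refine ⟨1, 85, one_pos, by norm_num, fun V _ s hs => ?_⟩
  obtain ⟨l, hl⟩ := exists_hullChain (s := s) hs.one_le
  refine ⟨1 :: l, hl.pairwise, fun k => ?_, rfl, hl.getLast?, fun σ hσ => ?_,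
    fun C hC hCV => ?_⟩
  · constructor
    · intro hk
      obtain ⟨h1, h2⟩ := hl.le_of_mem k hk
      exact ⟨h1, h2, (hl.mem_iff_isSupportedEv hs (isVertexSlope_one hs) h1 h2).1 hk⟩
    · rintro ⟨h1, h2, h3⟩
      exact (hl.mem_iff_isSupportedEv hs (isVertexSlope_one hs) h1 h2).2 h3
  · obtain ⟨σ', T, hex, hout, h1, h2⟩ := exec_grahamScan hs hl hσ
    refine ⟨σ', T, hex, hout, ?_, ?_⟩
    · rw [one_mul]
      exact_mod_cast h1
    · exact_mod_cast h2
  · obtain ⟨K, L, hpair, hK0, hKC, hCL, hL, r, w, hw⟩ := exists_pair_zero_cons hs hl hC hCV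
    exact ⟨K, L, hpair, w - r * C, klPolicy_isGainOptimal hs hw hK0 hKC hCL hL,
      isAverageOccupancyOptimum_of_support hs hKC hCL hL hK0 hw.le hw.left hw.right⟩
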